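/- Conventions. Algebras are associative unital $\mathbb C$-algebras; locally convex spaces are complex. An Arens–Michael algebra is an algebra on a complete Hausdorff locally convex space whose topology is generated by submultiplicative seminorms. A family $(\|\cdot\|_\lambda)$ of seminorms is directed if it is nonempty and any two members are dominated, up to a constant, by a third one. Let $A$ be an Arens–Michael algebra, $\alpha$ an algebra automorphism of $A$ that is continuous together with $\alpha^{-1}$, and $\{\|\cdot\|_\lambda\}_{\lambda\in\Lambda}$ a directed family of seminorms generating the topology of $A$. For an automorphism $\beta$, let $A_\beta$ be the $A$-bimodule equal to $A$ as a left module (and as a locally convex space), with right action $x\circ a=x\,\beta(a)$, and let $A[t;\beta]$ be the algebra of polynomials $\sum a_nt^n$ with $ta=\beta(a)t$. Let $W_2$ be the set of words in the letters $1,2$. For a word $w=(w(1),\dots,w(n))$ put $p(w,k)=\sum_{j\le k}(3-2w(j))$ and $i_w(r_1,\dots,r_n)=r_1\,\alpha^{p(w,1)}(r_2)\cdots\alpha^{p(w,n-1)}(r_n)$, let $\|\cdot\|^{(\emptyset)}_\lambda=\|\cdot\|_\lambda$, and for $n\ge1$ $$\|r\|^{(w)}_\lambda=\inf\Big\{\sum_{j=1}^k\|r_{1,j}\|_\lambda\cdots\|r_{n,j}\|_\lambda\;:\;r=\sum_{j=1}^k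 i_w(r_{1,j},\dots,r_{n,j})\Big\}.$$ Let $A\{x_1,x_2;\alpha\}$ be the space of all formal series $f=\sum_{w\in W_2}a_wx^w$, $a_w\in A$, such that $\|f\|_{\lambda,\rho}=\sum_w\|a_w\|^{(w)}_\lambda\rho^{|w|}<\infty$ for all $\lambda\in\Lambda$ and $0<\rho<\infty$, with the topology generated by the seminorms $\|\cdot\|_{\lambda,\rho}$. Let $M=A_\alpha\oplus A_{\alpha^{-1}}$, with any directed family of seminorms $\{\|\cdot\|_\nu\}$ generating its topology. Let $\widehat T_A(M)$ be the locally convex space $A\oplus\widehat T_A(M)^+$, where $\widehat T_A(M)^+$ consists of the sequences $(y_n)_{n\ge1}$, $y_n\in M^{\hat\otimes_A n}$, with $\|(y_n)\|_{\nu,\rho}=\sum_n\|y_n\|_\nu^{\hat\otimes n}\rho^n<\infty$ for all $\nu$ and $0<\rho<\infty$, topologized by these seminorms. Here $M^{\hat\otimes_A n}$ is the Hausdorff completion of the algebraic tensor power $M^{\otimes_A n}$ with respect to the projective tensor powers $\|\cdot\|_\nu^{\otimes n}$ of the seminorms. **Theorem.** (a) There is exactly one algebra structure on $\widehat T_A(M)$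 that makes it an Arens–Michael algebra and the natural inclusion $T_A(M)=A\oplus\bigoplus_{n\ge1}M^{\otimes_A n}\to\widehat T_A(M)$ an algebra homomorphism. (b) With this structure on $\widehat T_A(M)$, there is exactly one algebra structure on $A\{x_1,x_2;\alpha\}$ satisfying the following two conditions: 1. the natural maps $A[t;\alpha]\to A\{x_1,x_2;\alpha\}$, $\sum a_nt^n\mapsto\sum a_nx_1^n$, and $A[s;\alpha^{-1}]\to A\{x_1,x_2;\alpha\}$, $\sum a_ns^n\mapsto\sum a_nx_2^n$, are algebra homomorphisms; 2. the canonical map $\psi$ is a well-defined isomorphism of topological $A$-algebras from $A\{x_1,x_2;\alpha\}$ onto $\widehat T_A(M)$. Here $\psi\big(\sum_w a_wx^w\big)$ has the component $a_\emptyset$ in degree $0$ and the component $\sum_{|w|=n}a_w\otimes1\otimes\cdots\otimes1$ in degree $n\ge1$, where the $k$-th factor of the summand for $w$ lies in the summand $A_\alpha$ of $M$ if $w(k)=1$ and in $A_{\alpha^{-1}}$ if $w(k)=2$. (c) With this algebra structure, $A\{x_1,x_2;\alpha\}$ is an Arens–Michael algebra. -/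

import Mathlib

noncomputable section

open scoped TensorProduct

namespace AnalyticOre

/-! ### Locally convex spaces given by families of seminorms -/

section Seminorms

variable {X κ : Type*} [AddCommGroup X] [Module ℂ X]

/-- The uniform structure (of a locally convex space) generated by a family of seminorms. -/
@[reducible]
def seminormUniformSpace (P : κ → Seminorm ℂ X) : UniformSpace X :=
  ⨅ k, (P k).toSeminormedAddCommGroup.toUniformSpace

theorem seminormUniformSpace_isUniformAddGroup (P : κ → Seminorm ℂ X) :
    @IsUniformAddGroup X (seminormUniformSpace P) _ :=
  isUniformAddGroup_iInf fun _ => inferInstance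

theorem seminormUniformSpace_withSeminorms (P : κ → Seminorm ℂ X) :
    @WithSeminorms ℂ X κ _ _ _ P (seminormUniformSpace P).toTopologicalSpace := by
  let _ := seminormUniformSpace P
  have := seminormUniformSpace_isUniformAddGroup P
  exact (SeminormFamily.withSeminorms_iff_uniformSpace_eq_iInf P).2 rfl

theorem seminormUniformSpace_uniformContinuousConstSMul (P : κ → Seminorm ℂ X) :
    @UniformContinuousConstSMul ℂ X (seminormUniformSpace P) _ := by
  let _ := seminormUniformSpace P
  have := seminormUniformSpace_isUniformAddGroup P
  have := (seminormUniformSpace_withSeminorms P).continuousSMul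
  exact uniformContinuousConstSMul_of_continuousConstSMul ℂ X

/-- A family of seminorms is directed if any two of its members are dominated, up to a constant,
by a third one. -/
def IsDirectedFamily (P : κ → Seminorm ℂ X) : Prop :=
  Nonempty κ ∧ ∀ i j, ∃ k, ∃ C : ℝ, ∀ x, P i x ≤ C * P k x ∧ P j x ≤ C * P k x

end Seminorms

/-! ### Algebra structures and Arens-Michael algebras -/

/-- The structure of an associative unital complex algebra on a complex vector space. -/
@[ext]
structure AlgStructure (X : Type*) [AddCommGroup X] [Module ℂ X] where
  mul : X →ₗ[ℂ] X →ₗ[ℂ] X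
  one : X
  mul_assoc : ∀ x y z, mul (mul x y) z = mul x (mul y z)
  one_mul : ∀ x, mul one x = x
  mul_one : ∀ x, mul x one = x

/-- A locally convex space with a multiplication is an Arens-Michael algebra if it is complete
(and Hausdorff) and its topology is generated by a family of submultiplicative seminorms. (That
the multiplication makes the vector space into an algebra is required separately.) -/
structure IsArensMichael (X : Type*) [AddCommGroup X] [Module ℂ X] [UniformSpace X]
    (mul : X → X → X) : Prop where
  isUniformAddGroup : IsUniformAddGroup X
  t2Space : T2Space X
  completeSpace : CompleteSpace X
  exists_submultiplicative : ∃ P : Set (Seminorm ℂ X),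
    WithSeminorms (fun s : P => (s : Seminorm ℂ X)) ∧
      ∀ s ∈ P, ∀ x y, s (mul x y) ≤ s x * s y

/-! ### Projective seminorms -/

section Projective

variable {M X : Type*} [AddCommGroup M] [Module ℂ M] [AddCommGroup X] [Module ℂ X] {n : ℕ}

/-- The values `∑ j, p (x j 1) ⋯ p (x j n)` over all representations
`u = ∑ j, Φ (x j 1, …, x j n)` of `u`. -/
def projValues (Φ : MultilinearMap ℂ (fun _ : Fin n => M) X) (p : Seminorm ℂ M) (u : X) : Set ℝ :=
  {s | ∃ (k : ℕ) (x : Fin k → Fin n → M), u = ∑ j, Φ (x j) ∧ s = ∑ j, ∏ i, p (x j i)}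

variable (Φ : MultilinearMap ℂ (fun _ : Fin n => M) X) (p : Seminorm ℂ M)

theorem projValues_nonneg {u : X} {s : ℝ} (hs : s ∈ projValues Φ p u) : 0 ≤ s := by
  obtain ⟨k, x, -, rfl⟩ := hs
  exact Finset.sum_nonneg fun j _ => Finset.prod_nonneg fun i _ => apply_nonneg _ _

theorem projValues_bddBelow (u : X) : BddBelow (projValues Φ p u) :=
  ⟨0, fun _ hs => projValues_nonneg Φ p hs⟩

theorem projValues_add {u v : X} {s t : ℝ} (hs : s ∈ projValues Φ p u)
    (ht : t ∈ projValues Φ p v) : s + t ∈ projValues Φ p (u + v) := by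
  obtain ⟨k, x, rfl, rfl⟩ := hs
  obtain ⟨l, y, rfl, rfl⟩ := ht
  refine ⟨k + l, Fin.append x y, ?_, ?_⟩ <;> simp [Fin.sum_univ_add]

end Projective

section ProjectiveSeminorm

variable {M X : Type*} [AddCommGroup M] [Module ℂ M] [AddCommGroup X] [Module ℂ X] {n : ℕ}
variable (Φ : MultilinearMap ℂ (fun _ : Fin (n + 1) => M) X) (p : Seminorm ℂ M)

theorem projValues_smul (c : ℂ) {u : X} {s : ℝ} (hs : s ∈ projValues Φ p u) :
    ‖c‖ * s ∈ projValues Φ p (c • u) := by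
  obtain ⟨k, x, rfl, rfl⟩ := hs
  refine ⟨k, fun j => Function.update (x j) 0 (c • x j 0), ?_, ?_⟩
  · simp [Finset.smul_sum]
  · rw [Finset.mul_sum]
    refine Finset.sum_congr rfl fun j _ => ?_
    simp [Fin.prod_univ_succ, map_smul_eq_mul, mul_assoc]

theorem projValues_nonempty (hΦ : Submodule.span ℂ (Set.range Φ) = ⊤) (u : X) :
    (projValues Φ p u).Nonempty := by
  have hu : u ∈ Submodule.span ℂ (Set.range Φ) := hΦ ▸ Submodule.mem_top
  induction hu using Submodule.span_induction with
  | mem v hv =>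
    obtain ⟨x, rfl⟩ := hv
    exact ⟨_, 1, fun _ => x, by simp, rfl⟩
  | zero => exact ⟨0, 0, Fin.elim0, by simp, by simp⟩
  | add v w _ _ hv hw =>
    obtain ⟨s, hs⟩ := hv
    obtain ⟨t, ht⟩ := hw
    exact ⟨_, projValues_add Φ p hs ht⟩
  | smul c v _ hv =>
    obtain ⟨s, hs⟩ := hv
    exact ⟨_, projValues_smul Φ p c hs⟩

/-- The projective seminorm
`u ↦ inf { ∑ j, p (x j 1) ⋯ p (x j n) : u = ∑ j, Φ (x j 1, …, x j n) }` on the target of a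
multilinear map whose values span. -/
def projSeminorm (hΦ : Submodule.span ℂ (Set.range Φ) = ⊤) : Seminorm ℂ X :=
  Seminorm.ofSMulLE (fun u => sInf (projValues Φ p u))
    (le_antisymm (csInf_le (projValues_bddBelow Φ p 0) ⟨0, Fin.elim0, by simp, by simp⟩)
      (Real.sInf_nonneg fun _ hs => projValues_nonneg Φ p hs))
    (fun u v => by
      refine le_of_forall_pos_le_add fun ε hε => ?_
      obtain ⟨s, hs, hs'⟩ := exists_lt_of_csInf_lt (projValues_nonempty Φ p hΦ u)
        (lt_add_of_pos_right (sInf (projValues Φ p u)) (half_pos hε))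
      obtain ⟨t, ht, ht'⟩ := exists_lt_of_csInf_lt (projValues_nonempty Φ p hΦ v)
        (lt_add_of_pos_right (sInf (projValues Φ p v)) (half_pos hε))
      have := csInf_le (projValues_bddBelow Φ p (u + v)) (projValues_add Φ p hs ht)
      linarith)
    (fun c u => by
      rcases eq_or_ne c 0 with rfl | hc
      · obtain ⟨s, hs⟩ := projValues_nonempty Φ p hΦ u
        have := csInf_le (projValues_bddBelow Φ p _) (projValues_smul Φ p 0 hs)
        simpa using this
      · have hc' : 0 < ‖c‖ := norm_pos_iff.2 hc
        rw [← div_le_iff₀' hc']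
        refine le_csInf (projValues_nonempty Φ p hΦ u) fun s hs => ?_
        rw [div_le_iff₀' hc']
        exact csInf_le (projValues_bddBelow Φ p _) (projValues_smul Φ p c hs))

end ProjectiveSeminorm

/-! ### Weighted `ℓ¹`-sums of seminormed spaces -/

section WeightedSum

variable {I Λ : Type*} {E : I → Type*} [∀ i, AddCommGroup (E i)] [∀ i, Module ℂ (E i)]

/-- The families `x = (x i)` with `∑ i, N l i (x i) * ρ ^ d i < ∞` for all `l` and all `ρ > 0`. -/
def weightedSubmodule (d : I → ℕ) (N : Λ → ∀ i, Seminorm ℂ (E i)) : Submodule ℂ (∀ i, E i) where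
  carrier := {x | ∀ (l : Λ) (ρ : ℝ), 0 < ρ → Summable fun i => N l i (x i) * ρ ^ d i}
  add_mem' {x y} hx hy l ρ hρ := by
    refine Summable.of_nonneg_of_le (fun i => by positivity) (fun i => ?_)
      ((hx l ρ hρ).add (hy l ρ hρ))
    rw [← add_mul]
    exact mul_le_mul_of_nonneg_right (map_add_le_add _ _ _) (by positivity)
  zero_mem' l ρ _ := by simp [summable_zero]
  smul_mem' c x hx l ρ hρ := by
    simpa [map_smul_eq_mul, mul_assoc] using (hx l ρ hρ).mul_left ‖c‖

/-- The space of all `x = (x i)` with `‖x‖_{l, ρ} = ∑ i, N l i (x i) * ρ ^ d i < ∞` for all `l` and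
all `ρ > 0`; its topology is the one generated by the seminorms `‖·‖_{l, ρ}`. -/
def WeightedSum (d : I → ℕ) (N : Λ → ∀ i, Seminorm ℂ (E i)) : Type _ :=
  ↥(weightedSubmodule d N)

namespace WeightedSum

variable (d : I → ℕ) (N : Λ → ∀ i, Seminorm ℂ (E i))

instance : AddCommGroup (WeightedSum d N) := inferInstanceAs (AddCommGroup ↥(weightedSubmodule d N))

instance : Module ℂ (WeightedSum d N) := inferInstanceAs (Module ℂ ↥(weightedSubmodule d N))

/-- The family of coefficients. -/
def coeff : WeightedSum d N →ₗ[ℂ] ∀ i, E i := (weightedSubmodule d N).subtype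

theorem summable (x : WeightedSum d N) (l : Λ) {ρ : ℝ} (hρ : 0 < ρ) :
    Summable fun i => N l i (coeff d N x i) * ρ ^ d i :=
  x.2 l ρ hρ

/-- The seminorm `‖x‖_{l, ρ} = ∑ i, N l i (x i) * ρ ^ d i`. -/
def norm (l : Λ) (ρ : Set.Ioi (0 : ℝ)) : Seminorm ℂ (WeightedSum d N) :=
  Seminorm.of (fun x => ∑' i, N l i (coeff d N x i) * (ρ : ℝ) ^ d i)
    (fun x y => by
      have hρ : (0 : ℝ) < ρ := ρ.2
      rw [← (summable d N x l hρ).tsum_add (summable d N y l hρ)]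
      refine (summable d N (x + y) l hρ).tsum_le_tsum (fun i => ?_)
        ((summable d N x l hρ).add (summable d N y l hρ))
      rw [← add_mul, map_add]
      exact mul_le_mul_of_nonneg_right (map_add_le_add _ _ _) (by positivity))
    (fun c x => by
      simp only [map_smul, Pi.smul_apply, map_smul_eq_mul, mul_assoc]
      exact tsum_mul_left)

instance : UniformSpace (WeightedSum d N) :=
  seminormUniformSpace fun k : Λ × Set.Ioi (0 : ℝ) => norm d N k.1 k.2

/-- The family whose only nonzero coefficient is `e`, at `i`. -/
def single [DecidableEq I] (i : I) : E i →ₗ[ℂ] WeightedSum d N :=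
  LinearMap.codRestrict (weightedSubmodule d N) (LinearMap.single ℂ E i) fun e l ρ _ => by
    refine summable_of_ne_finset_zero (s := {i}) fun j hj => ?_
    have hji : j ≠ i := by simpa using hj
    simp [hji]

end WeightedSum

end WeightedSum

/-! ### Completed tensor powers over an algebra and the analytic tensor algebra -/

section TensorAlgebra

variable (A : Type*) {M κ : Type*} [Ring A] [AddCommGroup M] [Module ℂ M] [Module A M]
  [Module Aᵐᵒᵖ M]

/-- The relations
`⋯ ⊗ x i · a ⊗ x (i + 1) ⊗ ⋯ = ⋯ ⊗ x i ⊗ a · x (i + 1) ⊗ ⋯`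
in the `n`-th tensor power over `ℂ` of an `A`-bimodule. -/
def balancedRelations (M : Type*) [AddCommGroup M] [Module ℂ M] [Module A M] [Module Aᵐᵒᵖ M]
    (n : ℕ) : Submodule ℂ (⨂[ℂ] _ : Fin n, M) :=
  Submodule.span ℂ {t | ∃ (x : Fin n → M) (a : A) (i j : Fin n), (i : ℕ) + 1 = j ∧
    t = PiTensorProduct.tprod ℂ (Function.update x i (MulOpposite.op a • x i)) -
      PiTensorProduct.tprod ℂ (Function.update x j (a • x j))}

/-- The algebraic tensor power `M ⊗_A ⋯ ⊗_A M` with `n + 1` factors. The family `q` of seminorms on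
`M` determines its topology. -/
def TensorPow (_q : κ → Seminorm ℂ M) (n : ℕ) : Type _ :=
  (⨂[ℂ] _ : Fin (n + 1), M) ⧸ balancedRelations A M (n + 1)

variable (q : κ → Seminorm ℂ M)

namespace TensorPow

variable (n : ℕ)

instance : AddCommGroup (TensorPow A q n) :=
  inferInstanceAs (AddCommGroup ((⨂[ℂ] _ : Fin (n + 1), M) ⧸ balancedRelations A M (n + 1)))

instance : Module ℂ (TensorPow A q n) :=
  inferInstanceAs (Module ℂ ((⨂[ℂ] _ : Fin (n + 1), M) ⧸ balancedRelations A M (n + 1)))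

/-- The quotient map from the tensor power over `ℂ`. -/
def mk : (⨂[ℂ] _ : Fin (n + 1), M) →ₗ[ℂ] TensorPow A q n :=
  (balancedRelations A M (n + 1)).mkQ

theorem range_mk : LinearMap.range (mk A q n) = ⊤ :=
  LinearMap.range_eq_top.2 (Submodule.mkQ_surjective (balancedRelations A M (n + 1)))

/-- The elementary tensors `x 0 ⊗ ⋯ ⊗ x n`. -/
def tmul : MultilinearMap ℂ (fun _ : Fin (n + 1) => M) (TensorPow A q n) :=
  (mk A q n).compMultilinearMap (PiTensorProduct.tprod ℂ)

theorem span_tmul : Submodule.span ℂ (Set.range (tmul A q n)) = ⊤ := by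
  have h : Set.range (tmul A q n) =
      mk A q n '' Set.range (PiTensorProduct.tprod ℂ (s := fun _ : Fin (n + 1) => M)) := by
    rw [← Set.range_comp]; rfl
  rw [h, ← Submodule.map_span, PiTensorProduct.span_tprod_eq_top, Submodule.map_top, range_mk]

/-- The projective tensor power of the seminorm `q k`. -/
def seminorm (k : κ) : Seminorm ℂ (TensorPow A q n) :=
  projSeminorm (tmul A q n) (q k) (span_tmul A q n)

instance : UniformSpace (TensorPow A q n) := seminormUniformSpace (seminorm A q n)

instance : IsUniformAddGroup (TensorPow A q n) := seminormUniformSpace_isUniformAddGroup _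

instance : UniformContinuousConstSMul ℂ (TensorPow A q n) :=
  seminormUniformSpace_uniformContinuousConstSMul _

theorem uniformContinuous_seminorm (k : κ) : UniformContinuous (seminorm A q n k) :=
  Seminorm.uniformContinuous_of_continuousAt_zero
    ((seminormUniformSpace_withSeminorms (seminorm A q n)).continuous_seminorm k).continuousAt

end TensorPow

/-- The completed projective tensor power `M ⊗̂_A ⋯ ⊗̂_A M` with `n + 1` factors: the Hausdorff
completion of the algebraic one with respect to the projective tensor powers of the seminorms. -/
abbrev TensorPowHat (n : ℕ) : Type _ := UniformSpace.Completion (TensorPow A q n)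

/-- The continuous extension of the projective tensor power of `q k` to the completion. -/
def hatSeminorm (k : κ) (n : ℕ) : Seminorm ℂ (TensorPowHat A q n) :=
  Seminorm.of (UniformSpace.Completion.extension (TensorPow.seminorm A q n k))
    (fun x y => by
      refine UniformSpace.Completion.induction_on₂ x y ?_ fun a b => ?_
      · exact isClosed_le (UniformSpace.Completion.continuous_extension.comp continuous_add)
          ((UniformSpace.Completion.continuous_extension.comp continuous_fst).add
            (UniformSpace.Completion.continuous_extension.comp continuous_snd))
      · have h := TensorPow.uniformContinuous_seminorm A q n k
        rw [← UniformSpace.Completion.coe_add, UniformSpace.Completion.extension_coe h,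
          UniformSpace.Completion.extension_coe h, UniformSpace.Completion.extension_coe h]
        exact map_add_le_add _ _ _)
    (fun c x => by
      refine UniformSpace.Completion.induction_on x ?_ fun a => ?_
      · exact isClosed_eq (UniformSpace.Completion.continuous_extension.comp
            (continuous_const_smul c))
          (continuous_const.mul UniformSpace.Completion.continuous_extension)
      · have h := TensorPow.uniformContinuous_seminorm A q n k
        rw [← UniformSpace.Completion.coe_smul, UniformSpace.Completion.extension_coe h,
          UniformSpace.Completion.extension_coe h]
        exact map_smul_eq_mul _ _ _)

/-- The positive part of the analytic tensor algebra of an `A`-bimodule `M` whose topology is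
generated by the directed family `q`: the sequences of `x n ∈ M^{⊗̂ (n + 1)}` such that
`∑ n, ‖x n‖_k * ρ ^ (n + 1) < ∞` for all `k` and all `ρ > 0`. -/
abbrev TensorHatPos : Type _ :=
  WeightedSum (fun n : ℕ => n + 1) (hatSeminorm A q)

/-- The locally convex space underlying the analytic tensor algebra of `M`. -/
abbrev TensorHat : Type _ := A × TensorHatPos A q

/-- The inclusion of the degree zero part `A`. -/
def inclZero (a : A) : TensorHat A q := (a, 0)

/-- The elementary tensor `x 0 ⊗ ⋯ ⊗ x n` as an element of the analytic tensor algebra. -/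
def inclTensor {n : ℕ} (x : Fin (n + 1) → M) : TensorHat A q :=
  (0, WeightedSum.single _ (hatSeminorm A q) n (TensorPow.tmul A q n x : TensorPowHat A q n))

/-- An algebra structure is the one of the analytic tensor algebra if it makes the space into an
Arens-Michael algebra and the inclusion of the algebraic tensor algebra `A ⊕ ⨁ M^{⊗_A n}` into an
algebra homomorphism. The latter is expressed on `A` and the elementary tensors, which span. -/
structure IsTensorAlgebraStructure [Algebra ℂ A] [UniformSpace A]
    (T : AlgStructure (TensorHat A q)) : Prop where
  isArensMichael : IsArensMichael (TensorHat A q) (fun x y => T.mul x y)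
  one_eq : T.one = inclZero A q 1
  zero_mul_zero : ∀ a b : A, T.mul (inclZero A q a) (inclZero A q b) = inclZero A q (a * b)
  zero_mul_tensor : ∀ (a : A) {n : ℕ} (x : Fin (n + 1) → M),
    T.mul (inclZero A q a) (inclTensor A q x) = inclTensor A q (Function.update x 0 (a • x 0))
  tensor_mul_zero : ∀ (a : A) {n : ℕ} (x : Fin (n + 1) → M),
    T.mul (inclTensor A q x) (inclZero A q a) =
      inclTensor A q (Function.update x (Fin.last n) (MulOpposite.op a • x (Fin.last n)))
  tensor_mul_tensor : ∀ {m n : ℕ} (x : Fin (m + 1) → M) (y : Fin (n + 1) → M),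
    T.mul (inclTensor A q x) (inclTensor A q y) =
      inclTensor A q (n := m + 1 + n) (Fin.append x y : Fin (m + 1 + (n + 1)) → M)

end TensorAlgebra

/-! ### Twisted bimodules -/

section Twist

variable {A : Type*} [Ring A] [Algebra ℂ A]

/-- The `A`-bimodule `A_α`: it is `A` as a left module, and `x ∘ a = x * α a`. -/
def Twist (_α : A ≃ₐ[ℂ] A) : Type _ := A

namespace Twist

variable (α : A ≃ₐ[ℂ] A)

instance : AddCommGroup (Twist α) := inferInstanceAs (AddCommGroup A)

instance : Module ℂ (Twist α) := inferInstanceAs (Module ℂ A)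

instance : Module A (Twist α) := inferInstanceAs (Module A A)

instance [UniformSpace A] : UniformSpace (Twist α) := inferInstanceAs (UniformSpace A)

/-- An element of `A`, regarded as an element of `A_α`. -/
def of (a : A) : Twist α := a

/-- An element of `A_α`, regarded as an element of `A`. -/
def val (x : Twist α) : A := x

instance : Module Aᵐᵒᵖ (Twist α) where
  smul a x := of α (val α x * α a.unop)
  one_smul x := by
    change val α x * α 1 = val α x
    simp
  mul_smul a b x := by
    change val α x * α (b.unop * a.unop) = val α x * α b.unop * α a.unop
    simp [mul_assoc]
  smul_zero a := zero_mul (α a.unop)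
  smul_add a x y := add_mul (val α x) (val α y) (α a.unop)
  add_smul a b x := by
    change val α x * α (a.unop + b.unop) = val α x * α a.unop + val α x * α b.unop
    simp [mul_add]
  zero_smul x := by
    change val α x * α 0 = 0
    simp

end Twist

/-- The element `(a, 0)` or `(0, a)` of `A_α ⊕ A_{α⁻¹}`; the letters `1`, `2` are represented by
`0, 1 : Fin 2`. -/
def letterIncl (α : A ≃ₐ[ℂ] A) (i : Fin 2) (a : A) : Twist α × Twist α⁻¹ :=
  if i = 0 then (Twist.of α a, 0) else (0, Twist.of α⁻¹ a)

end Twist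

/-! ### Skew power series in two letters -/

/-- Words in two letters. -/
abbrev Word : Type := Σ n : ℕ, (Fin n → Fin 2)

section Series

variable {A : Type*} [Ring A] [Algebra ℂ A]

/-- The sum of the first `k` letters of `w`, where the letter `1` (here `0`) counts as `1` and the
letter `2` (here `1`) counts as `-1`. -/
def partialExp {n : ℕ} (w : Fin n → Fin 2) (k : Fin n) : ℤ :=
  ∑ j : Fin n, if j < k then (if w j = 0 then 1 else -1) else 0

/-- The multilinear map `(x 0, x 1, …) ↦ x 0 * α^{p(w, 1)} (x 1) * α^{p(w, 2)} (x 2) * ⋯`. -/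
def wordMap (α : A ≃ₐ[ℂ] A) {n : ℕ} (w : Fin n → Fin 2) :
    MultilinearMap ℂ (fun _ : Fin n => A) A :=
  (MultilinearMap.mkPiAlgebraFin ℂ n A).compLinearMap
    fun k => (α ^ partialExp w k : A ≃ₐ[ℂ] A).toLinearMap

theorem span_wordMap (α : A ≃ₐ[ℂ] A) {n : ℕ} (w : Fin (n + 1) → Fin 2) :
    Submodule.span ℂ (Set.range (wordMap α w)) = ⊤ := by
  refine Submodule.eq_top_iff'.2 fun a => Submodule.subset_span ⟨Fin.cons a fun _ => 1, ?_⟩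
  simp [wordMap, MultilinearMap.mkPiAlgebraFin_apply, List.ofFn_succ, partialExp]

/-- The seminorm `‖·‖^{(w)}` on `A` obtained from a seminorm `p = ‖·‖`; for the empty word it is
`p` itself. -/
def wordSeminorm (α : A ≃ₐ[ℂ] A) (p : Seminorm ℂ A) : Word → Seminorm ℂ A
  | ⟨0, _⟩ => p
  | ⟨_ + 1, w⟩ => projSeminorm (wordMap α w) p (span_wordMap α w)

variable {Λ : Type*}

/-- The locally convex space `A{x₁, x₂; α}` of the series `∑ a_w x^w` over all words `w` with
`∑ ‖a_w‖_l^{(w)} ρ^{|w|} < ∞` for all `l` and all `ρ > 0`. -/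
abbrev SkewSeries (α : A ≃ₐ[ℂ] A) (p : Λ → Seminorm ℂ A) : Type _ :=
  WeightedSum (E := fun _ : Word => A) (fun w => w.1) (fun l w => wordSeminorm α (p l) w)

namespace SkewSeries

variable (α : A ≃ₐ[ℂ] A) (p : Λ → Seminorm ℂ A)

/-- The coefficient `a_w` of a series. -/
def coeff (f : SkewSeries α p) (w : Word) : A := WeightedSum.coeff _ _ f w

/-- The series `a x^w`. -/
def monomial (w : Word) : A →ₗ[ℂ] SkewSeries α p :=
  WeightedSum.single (E := fun _ : Word => A) _ _ w

end SkewSeries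

/-- A copy of `A`, on which the generator of the free monoid on one generator acts by `β`. -/
def OreCoeff (_β : A ≃ₐ[ℂ] A) : Type _ := A

instance (β : A ≃ₐ[ℂ] A) : Ring (OreCoeff β) := inferInstanceAs (Ring A)

instance (β : A ≃ₐ[ℂ] A) : Module ℂ (OreCoeff β) := inferInstanceAs (Module ℂ A)

instance (β : A ≃ₐ[ℂ] A) : MulSemiringAction (Multiplicative ℕ) (OreCoeff β) where
  smul k a := (β ^ k.toAdd : A ≃ₐ[ℂ] A) a
  one_smul a := by
    change (β ^ 0 : A ≃ₐ[ℂ] A) a = a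
    rw [pow_zero]
    rfl
  mul_smul k l a := by
    change (β ^ (k.toAdd + l.toAdd) : A ≃ₐ[ℂ] A) a = (β ^ k.toAdd) ((β ^ l.toAdd) a)
    rw [pow_add]
    rfl
  smul_zero k := map_zero (β ^ k.toAdd : A ≃ₐ[ℂ] A)
  smul_add k := map_add (β ^ k.toAdd : A ≃ₐ[ℂ] A)
  smul_one k := map_one (β ^ k.toAdd : A ≃ₐ[ℂ] A)
  smul_mul k := map_mul (β ^ k.toAdd : A ≃ₐ[ℂ] A)

/-- The Ore extension `A[t; β]`: the polynomials `∑ a_n t^n` with the multiplication determined by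
`t a = β(a) t`. -/
abbrev OreExtension (β : A ≃ₐ[ℂ] A) : Type _ := SkewPolynomial (OreCoeff β)

/-- The natural inclusion `∑ a_n t^n ↦ ∑ a_n x_i^n` of `A[t; β]` into `A{x₁, x₂; α}`; here `i` is
`0` for `x₁` and `1` for `x₂`. -/
def oreIncl (α : A ≃ₐ[ℂ] A) (p : Λ → Seminorm ℂ A) (β : A ≃ₐ[ℂ] A) (i : Fin 2) :
    OreExtension β →ₗ[ℂ] SkewSeries α p where
  toFun f := SkewPolynomial.sum f fun n (a : A) => SkewSeries.monomial α p ⟨n, fun _ => i⟩ a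
  map_add' f g := by
    refine SkewMonoidAlgebra.sum_add_index (fun _ _ => ?_) (fun _ _ a b => ?_)
    · exact map_zero (SkewSeries.monomial α p _)
    · exact map_add (SkewSeries.monomial α p _) a b
  map_smul' c f := by
    refine (SkewMonoidAlgebra.sum_smul_index' (fun _ => ?_)).trans ?_
    · exact map_zero (SkewSeries.monomial α p _)
    · refine Eq.trans ?_ SkewMonoidAlgebra.smul_sum.symm
      congr 1
      funext n a
      exact map_smul (SkewSeries.monomial α p ⟨n.toAdd, fun _ => i⟩) c a

/-- A linear map from an Ore extension is a homomorphism of unital algebras. -/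
def IsOreHom {β : A ≃ₐ[ℂ] A} {X : Type*} [AddCommGroup X] [Module ℂ X] (μ : AlgStructure X)
    (g : OreExtension β →ₗ[ℂ] X) : Prop :=
  g 1 = μ.one ∧ ∀ f h, g (f * h) = μ.mul (g f) (g h)

/-- The map `ψ` from `A{x₁, x₂; α}` to the analytic tensor algebra of `A_α ⊕ A_{α⁻¹}` is the
canonical one: it sends `∑ a_w x^w` to the element with the components `a_∅` in degree zero and
`∑_{|w| = n + 1} a_w ⊗ 1 ⊗ ⋯ ⊗ 1` in degree `n + 1`, where the `k`-th factor lies in `A_α` or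
`A_{α⁻¹}` according to the `k`-th letter of `w`. -/
def IsCanonicalMap {κ : Type*} (α : A ≃ₐ[ℂ] A) (p : Λ → Seminorm ℂ A)
    (q : κ → Seminorm ℂ (Twist α × Twist α⁻¹)) (ψ : SkewSeries α p → TensorHat A q) : Prop :=
  ∀ f : SkewSeries α p,
    (ψ f).1 = SkewSeries.coeff α p f ⟨0, Fin.elim0⟩ ∧
    ∀ n : ℕ, WeightedSum.coeff _ _ (ψ f).2 n =
      ((∑ w : Fin (n + 1) → Fin 2, TensorPow.tmul A q n fun k => letterIncl α (w k)
          ((Fin.cons (SkewSeries.coeff α p f ⟨n + 1, w⟩) fun _ => 1 : Fin (n + 1) → A) k) :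
        TensorPow A q n) : TensorPowHat A q n)

/-- `μ` turns the canonical map into an isomorphism of topological `A`-algebras from
`A{x₁, x₂; α}` onto the analytic tensor algebra of `A_α ⊕ A_{α⁻¹}` with the multiplication `T`. -/
def IsCanonicallyIso {κ : Type*} [UniformSpace A] (α : A ≃ₐ[ℂ] A) (p : Λ → Seminorm ℂ A)
    (q : κ → Seminorm ℂ (Twist α × Twist α⁻¹)) (T : AlgStructure (TensorHat A q))
    (μ : AlgStructure (SkewSeries α p)) : Prop :=
  ∃ ψ : SkewSeries α p ≃L[ℂ] TensorHat A q,
    IsCanonicalMap α p q ψ ∧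
    ψ μ.one = T.one ∧
    (∀ f g, ψ (μ.mul f g) = T.mul (ψ f) (ψ g)) ∧
    ∀ a : A, ψ (SkewSeries.monomial α p ⟨0, Fin.elim0⟩ a) = inclZero A q a

end Series

end AnalyticOre

end

noncomputable section

open scoped TensorProduct

namespace AnalyticOre

/-! ### Continuity and bounds for seminorms -/

section SeminormBounds

open Filter Topology

variable {X Y κ κ' : Type*} [AddCommGroup X] [Module ℂ X] [AddCommGroup Y] [Module ℂ Y]

/-! In `M ⊗_A ⋯ ⊗_A M` every entry of an elementary tensor can be pushed to the first place:
crossing a letter applies `α` or `α⁻¹`. A tensor whose entries lie in the summands prescribed by a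
word `w` thus equals `i_w(r₁, …, r_n) ⊗ 1 ⊗ ⋯ ⊗ 1`, and the `n`-th tensor power is a direct sum of
copies of `A`, one for each word of length `n` (`balanced_eq_cons_wordMap`, `tensorPowEquiv`).

Under this identification the projective seminorm is comparable with the sum of the word seminorms,
up to a factor `C ^ n` (`boundedByWords_hat`, `boundsWords_hat`). Since all radii `ρ` are allowed,
such factors are absorbed by rescaling `ρ`. For a fixed word the word seminorms generate the
topology of `A` (`withSeminorms_wordSeminorm`), so the tensor powers are already complete and
Hausdorff, and `ψ` is a topological linear isomorphism (`exists_canonicalMap`).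

The multiplication must be `(a x^w)(b x^v) = a α^{p(w)}(b) x^{wv}`, where `p(w)` is the total
exponent of `w`. For nonempty words the identity `i_{wv}(r, s) = i_w(r) α^{p(w)}(i_v(s))`
(`wordMap_append`) makes the word seminorms submultiplicative. An empty word needs more: `a` must be
absorbed into the first entry, `b` into the last one as `α^{±1}(b)`. This works if one starts from a
submultiplicative seminorm `r` and uses `max(r, r ∘ α, r ∘ α⁻¹)` in degree zero
(`twistedWordSeminorm_skewCoeffMul_le`). The modified family defines the same space, which is
therefore an Arens-Michael algebra (`SkewSeries.exists_structure`).

Transport along `ψ` gives the algebra structure of the tensor algebra. Both uniqueness claims are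
formal: multiplication in an Arens-Michael algebra is separately continuous and the monomials span a
dense subspace (`IsTensorAlgebraStructure.unique`), while the formula for `ψ` determines `ψ`, hence
the multiplication of series (`IsCanonicallyIso.unique`). -/

theorem continuous_of_seminorm_bound [TopologicalSpace X] [IsTopologicalAddGroup X]
    [ContinuousConstSMul ℂ X] [TopologicalSpace Y]
    {q : κ → Seminorm ℂ Y} (hq : WithSeminorms q) (f : X →ₗ[ℂ] Y)
    (h : ∀ k, ∃ s : Seminorm ℂ X, Continuous s ∧ ∃ C : ℝ, ∀ x, q k (f x) ≤ C * s x) :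
    Continuous f := by
  refine WithSeminorms.continuous_of_continuous_comp hq f fun k => ?_
  obtain ⟨s, hs, C, hC⟩ := h k
  have hc : Continuous (Real.toNNReal C • s : Seminorm ℂ X) :=
    continuous_const.mul hs
  refine Seminorm.continuous_of_le hc fun x => ?_
  exact (hC x).trans (mul_le_mul_of_nonneg_right (Real.le_coe_toNNReal C) (apply_nonneg s x))

/-- Continuity gives a bound by a finite supremum; directedness collapses it to one member. A single
member is needed because projective seminorms are built from one seminorm at a time. The
normalization `1 ≤ C` makes powers of `C` comparable. -/
theorem exists_bound_of_directed [TopologicalSpace X] {p : κ → Seminorm ℂ X}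
    (hp : WithSeminorms p) (hd : IsDirectedFamily p) {s : Seminorm ℂ X} (hs : Continuous s) :
    ∃ l, ∃ C : ℝ, 1 ≤ C ∧ ∀ x, s x ≤ C * p l x := by
  have key : ∀ t : Finset κ, ∃ l, ∃ C : ℝ, 1 ≤ C ∧ ∀ x, t.sup p x ≤ C * p l x := by
    intro t
    induction t using Finset.cons_induction with
    | empty =>
      obtain ⟨l⟩ := hd.1
      exact ⟨l, 1, le_rfl, fun x => by simp⟩
    | cons a t ha ih =>
      obtain ⟨l, C, hC, h⟩ := ih
      obtain ⟨k, D, hD⟩ := hd.2 a l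
      refine ⟨k, C * max D 1, one_le_mul_of_one_le_of_one_le hC (le_max_right _ _), fun x => ?_⟩
      rw [Finset.sup_cons, Seminorm.sup_apply]
      have h0 := apply_nonneg (p k) x
      have h1 : D * p k x ≤ max D 1 * p k x :=
        mul_le_mul_of_nonneg_right (le_max_left _ _) h0
      have h2 : 0 ≤ max D 1 * p k x := by positivity
      refine max_le ?_ ?_
      · rw [mul_assoc]
        exact ((hD x).1.trans h1).trans (le_mul_of_one_le_left h2 hC)
      · rw [mul_assoc]
        exact (h x).trans (mul_le_mul_of_nonneg_left ((hD x).2.trans h1) (by linarith))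
  obtain ⟨t, C, -, hC⟩ := Seminorm.bound_of_continuous hp s hs
  obtain ⟨l, D, hD, h⟩ := key t
  refine ⟨l, max C 1 * D, one_le_mul_of_one_le_of_one_le (le_max_right _ _) hD, fun x => ?_⟩
  have h1 : s x ≤ C * t.sup p x := hC x
  rw [mul_assoc]
  refine h1.trans (mul_le_mul (le_max_left _ _) (h x) (apply_nonneg _ _) ?_)
  exact zero_le_one.trans (le_max_right _ _)

theorem withSeminorms_of_bounds [TopologicalSpace X] {p : κ → Seminorm ℂ X}
    {q : κ' → Seminorm ℂ X} (hp : WithSeminorms p) (hq : ∀ k, Continuous (q k))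
    (h : ∀ l, ∃ k, ∃ C : ℝ, ∀ x, p l x ≤ C * q k x) : WithSeminorms q := by
  refine hp.congr (fun k => ?_) fun l => ?_
  · obtain ⟨t, C, -, hC⟩ := Seminorm.bound_of_continuous hp (q k) (hq k)
    exact ⟨t, C, hC⟩
  · obtain ⟨k, C, hC⟩ := h l
    refine ⟨{k}, Real.toNNReal C, fun x => ?_⟩
    rw [Finset.sup_singleton]
    exact (hC x).trans (mul_le_mul_of_nonneg_right (Real.le_coe_toNNReal C) (apply_nonneg _ x))

theorem seminorm_sum_le (s : Seminorm ℂ X) {ι : Type*} (t : Finset ι) (x : ι → X) :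
    s (∑ i ∈ t, x i) ≤ ∑ i ∈ t, s (x i) :=
  Finset.le_sum_of_subadditive s (map_zero s).le (map_add_le_add s) t x

/-- Absolute convergence implies convergence by the Cauchy criterion: a neighbourhood of zero
contains a ball of a finite supremum of seminorms, and that supremum is at most their sum. -/
theorem summable_of_summable_seminorm [UniformSpace X] [IsUniformAddGroup X] [CompleteSpace X]
    {p : κ → Seminorm ℂ X} (hp : WithSeminorms p) {ι : Type*} {x : ι → X}
    (h : ∀ k, Summable fun i => p k (x i)) : Summable x := by
  rw [summable_iff_vanishing]
  intro U hU
  rw [hp.hasBasis_zero_ball.mem_iff] at hU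
  obtain ⟨⟨t, r⟩, hr, hU⟩ := hU
  have hs : Summable fun i => t.sup p (x i) := by
    refine Summable.of_nonneg_of_le (fun i => apply_nonneg _ _) (fun i => ?_)
      (summable_sum fun k (_ : k ∈ t) => h k)
    refine Seminorm.finset_sup_apply_le (Finset.sum_nonneg fun k _ => apply_nonneg _ _)
      fun k hk => ?_
    exact Finset.single_le_sum (f := fun k => p k (x i)) (fun k _ => apply_nonneg _ _) hk
  obtain ⟨s, hs⟩ := summable_iff_vanishing_norm.1 hs r hr
  refine ⟨s, fun u hu => hU ?_⟩
  rw [Seminorm.mem_ball_zero]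
  refine lt_of_le_of_lt ?_ (hs u hu)
  rw [Real.norm_of_nonneg (Finset.sum_nonneg fun k _ => apply_nonneg _ _)]
  exact seminorm_sum_le (t.sup p) u x

theorem seminorm_tsum_le [TopologicalSpace X] {s : Seminorm ℂ X} (hs : Continuous s)
    {ι : Type*} {x : ι → X} (hx : Summable x) (h : Summable fun i => s (x i)) :
    s (∑' i, x i) ≤ ∑' i, s (x i) := by
  have h1 : Tendsto (fun u : Finset ι => s (∑ i ∈ u, x i)) atTop (𝓝 (s (∑' i, x i))) :=
    (hs.tendsto _).comp hx.hasSum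
  refine le_of_tendsto h1 (Eventually.of_forall fun u => ?_)
  exact (seminorm_sum_le s u x).trans (h.sum_le_tsum u fun i _ => apply_nonneg _ _)

end SeminormBounds

/-! ### Bounds by projective seminorms. -/

section ProjectiveBounds

variable {M X : Type*} [AddCommGroup M] [Module ℂ M] [AddCommGroup X] [Module ℂ X] {n : ℕ}
variable {Φ : MultilinearMap ℂ (fun _ : Fin (n + 1) => M) X} {p : Seminorm ℂ M}
  (hΦ : Submodule.span ℂ (Set.range Φ) = ⊤)

theorem projSeminorm_apply_le (x : Fin (n + 1) → M) :
    projSeminorm Φ p hΦ (Φ x) ≤ ∏ i, p (x i) :=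
  csInf_le (projValues_bddBelow Φ p _) ⟨1, fun _ => x, by simp, by simp⟩

/-- The universal property of projective seminorms. -/
theorem le_projSeminorm {s : Seminorm ℂ X} {C : ℝ} (hC : 0 ≤ C)
    (h : ∀ x, s (Φ x) ≤ C * ∏ i, p (x i)) (u : X) : s u ≤ C * projSeminorm Φ p hΦ u := by
  have key : ∀ t ∈ projValues Φ p u, s u ≤ C * t := by
    rintro t ⟨k, x, rfl, rfl⟩
    rw [Finset.mul_sum]
    exact (seminorm_sum_le s _ _).trans (Finset.sum_le_sum fun j _ => h (x j))
  -- For `C = 0` division is impossible, but some representation of `u` exists because the values of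
  -- `Φ` span, and it gives `s u ≤ 0`.
  rcases hC.eq_or_lt with rfl | hC
  · obtain ⟨t, ht⟩ := projValues_nonempty Φ p hΦ u
    simpa using key t ht
  · rw [← div_le_iff₀' hC]
    refine le_csInf (projValues_nonempty Φ p hΦ u) fun t ht => ?_
    rw [div_le_iff₀' hC]
    exact key t ht

end ProjectiveBounds

/-! ### Weighted sums as locally convex spaces -/

namespace WeightedSum

open Filter Topology

variable {I Λ : Type*} {E : I → Type*} [∀ i, AddCommGroup (E i)] [∀ i, Module ℂ (E i)]
  (d : I → ℕ) (N : Λ → ∀ i, Seminorm ℂ (E i))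

instance : IsUniformAddGroup (WeightedSum d N) := seminormUniformSpace_isUniformAddGroup _

theorem withSeminorms :
    WithSeminorms fun k : Λ × Set.Ioi (0 : ℝ) => norm d N k.1 k.2 :=
  seminormUniformSpace_withSeminorms _

instance : ContinuousSMul ℂ (WeightedSum d N) := (withSeminorms d N).continuousSMul

theorem continuous_norm (l : Λ) (ρ : Set.Ioi (0 : ℝ)) : Continuous (norm d N l ρ) :=
  (withSeminorms d N).continuous_seminorm (l, ρ)

variable {d N}

theorem ext {x y : WeightedSum d N} (h : ∀ i, coeff d N x i = coeff d N y i) : x = y :=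
  Subtype.ext (funext h)

/-- The element with given coefficients. -/
def mk (x : ∀ i, E i)
    (hx : ∀ (l : Λ) (ρ : ℝ), 0 < ρ → Summable fun i => N l i (x i) * ρ ^ d i) :
    WeightedSum d N :=
  ⟨x, hx⟩

@[simp]
theorem coeff_mk (x : ∀ i, E i)
    (hx : ∀ (l : Λ) (ρ : ℝ), 0 < ρ → Summable fun i => N l i (x i) * ρ ^ d i) (i : I) :
    coeff d N (mk x hx) i = x i :=
  rfl

theorem norm_apply (l : Λ) (ρ : Set.Ioi (0 : ℝ)) (x : WeightedSum d N) :
    norm d N l ρ x = ∑' i, N l i (coeff d N x i) * (ρ : ℝ) ^ d i :=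
  rfl

theorem term_nonneg (l : Λ) (ρ : Set.Ioi (0 : ℝ)) (x : ∀ i, E i) (i : I) :
    0 ≤ N l i (x i) * (ρ : ℝ) ^ d i :=
  mul_nonneg (apply_nonneg _ _) (pow_nonneg (le_of_lt ρ.2) _)

theorem term_le_norm (l : Λ) (ρ : Set.Ioi (0 : ℝ)) (x : WeightedSum d N) (i : I) :
    N l i (coeff d N x i) * (ρ : ℝ) ^ d i ≤ norm d N l ρ x :=
  (summable d N x l ρ.2).le_tsum i fun j _ => term_nonneg l ρ _ j

theorem coeff_single [DecidableEq I] (i : I) (e : E i) :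
    coeff d N (single d N i e) = Pi.single i e :=
  rfl

theorem norm_single [DecidableEq I] (l : Λ) (ρ : Set.Ioi (0 : ℝ)) (i : I) (e : E i) :
    norm d N l ρ (single d N i e) = N l i e * (ρ : ℝ) ^ d i := by
  rw [norm_apply, tsum_eq_single i fun j hj => by simp [coeff_single, hj]]
  simp [coeff_single]

/-- The error of a finite partial sum has norm equal to the tail of a convergent numerical series.
Neither completeness nor a Hausdorff condition enters. -/
theorem hasSum_single [DecidableEq I] (x : WeightedSum d N) :
    HasSum (fun i => single d N i (coeff d N x i)) x := by
  refine ((withSeminorms d N).tendsto_nhds _ _).2 fun ⟨l, ρ⟩ ε hε => ?_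
  have h := tendsto_tsum_compl_atTop_zero fun i => N l i (coeff d N x i) * (ρ : ℝ) ^ d i
  filter_upwards [h.eventually_lt_const hε] with s hs
  refine lt_of_eq_of_lt ?_ hs
  change norm d N l ρ _ = _
  rw [norm_apply, ← tsum_subtype_eq_of_support_subset (s := {i | i ∉ s})]
  · refine tsum_congr fun i => ?_
    have hi : (i : I) ∉ s := i.2
    have : coeff d N (∑ b ∈ s, single d N b (coeff d N x b) - x) i = - coeff d N x i := by
      rw [map_sub, map_sum, Pi.sub_apply, Finset.sum_apply, Finset.sum_eq_zero, zero_sub]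
      intro j hj
      have : (i : I) ≠ j := fun h => hi (h ▸ hj)
      simp [coeff_single, this]
    rw [this, map_neg_eq_map]
  · intro i hi hs
    refine hi ?_
    change N l i (coeff d N (∑ b ∈ s, single d N b (coeff d N x b) - x) i) * (ρ : ℝ) ^ d i = 0
    have hs : i ∈ s := by simpa using hs
    have : coeff d N (∑ b ∈ s, single d N b (coeff d N x b) - x) i = 0 := by
      rw [map_sub, map_sum, Pi.sub_apply, Finset.sum_apply, Finset.sum_eq_single i]
      · simp [coeff_single]
      · intro j _ hj
        simp [coeff_single, hj.symm]
      · exact fun h => (h hs).elim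
    rw [this, map_zero, zero_mul]

/-- Density of the finitely supported families. Associativity, the unit laws and the uniqueness of
the tensor algebra structure are reduced to single coefficients in this way. -/
theorem linearMap_ext [DecidableEq I] {Y : Type*} [AddCommGroup Y] [Module ℂ Y]
    [TopologicalSpace Y] [T2Space Y] {f g : WeightedSum d N →ₗ[ℂ] Y} (hf : Continuous f)
    (hg : Continuous g) (h : ∀ i e, f (single d N i e) = g (single d N i e)) : f = g := by
  ext x
  have h1 := (hasSum_single x).map f hf
  have h2 := (hasSum_single x).map g hg
  refine h1.unique ?_
  convert h2 using 1
  exact funext fun i => h i _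

section Coefficients

variable [∀ i, TopologicalSpace (E i)]

theorem continuous_coeff [Nonempty Λ] (hN : ∀ i, WithSeminorms fun l => N l i) (i : I) :
    Continuous fun x : WeightedSum d N => coeff d N x i := by
  refine continuous_of_seminorm_bound (hN i)
    ((LinearMap.proj i).comp (coeff d N)) fun l => ⟨norm d N l ⟨1, Set.mem_Ioi.2 one_pos⟩,
      continuous_norm d N _ _, 1, fun x => ?_⟩
  simpa using term_le_norm l ⟨1, Set.mem_Ioi.2 one_pos⟩ x i

theorem t2Space [Nonempty Λ] [∀ i, T2Space (E i)] (hN : ∀ i, WithSeminorms fun l => N l i) :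
    T2Space (WeightedSum d N) := by
  refine T2Space.of_injective_continuous (f := fun x i => coeff d N x i) (fun x y h => ?_)
    (continuous_pi fun i => continuous_coeff hN i)
  exact ext fun i => congrFun h i

end Coefficients

/-- The classical argument for `ℓ¹`: take limits coordinatewise, then pass to the limit in estimates
of finite partial sums. -/
theorem completeSpace [Nonempty Λ] [∀ i, UniformSpace (E i)] [∀ i, IsUniformAddGroup (E i)]
    [∀ i, CompleteSpace (E i)] (hN : ∀ i, WithSeminorms fun l => N l i) :
    CompleteSpace (WeightedSum d N) := by
  refine ⟨fun {F} hF => ?_⟩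
  have hFne : F.NeBot := hF.1
  have hu : ∀ i, UniformContinuous fun x : WeightedSum d N => coeff d N x i := fun i => by
    refine uniformContinuous_addMonoidHom_of_continuous
      (f := ((LinearMap.proj i).comp (coeff d N)).toAddMonoidHom) ?_
    exact continuous_coeff hN i
  choose y hy using fun i => CompleteSpace.complete (hF.map (hu i))
  -- The set `S` does not depend on the finite set `J`. The estimate therefore yields both that `y`
  -- lies in the space (with `ε = 1`) and that the filter converges to it.
  have key : ∀ (l : Λ) (ρ : Set.Ioi (0 : ℝ)) (ε : ℝ), 0 < ε → ∃ S ∈ F, ∀ x ∈ S,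
      ∀ J : Finset I, ∑ i ∈ J, N l i (coeff d N x i - y i) * (ρ : ℝ) ^ d i ≤ ε := by
    intro l ρ ε hε
    have hV : {z : WeightedSum d N × WeightedSum d N | norm d N l ρ (z.1 - z.2) < ε} ∈
        uniformity (WeightedSum d N) := by
      have hc : Continuous fun z : WeightedSum d N => norm d N l ρ z := continuous_norm d N l ρ
      have h0 : {z : WeightedSum d N | norm d N l ρ z < ε} ∈ 𝓝 (0 : WeightedSum d N) :=
        (isOpen_lt hc continuous_const).mem_nhds (by simpa using hε)
      rw [uniformity_eq_comap_nhds_zero_swapped]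
      exact ⟨_, h0, fun z hz => hz⟩
    obtain ⟨S, hS, hSV⟩ := (cauchy_iff.1 hF).2 _ hV
    refine ⟨S, hS, fun x hx J => ?_⟩
    have hlim : Tendsto (fun x' : WeightedSum d N =>
        ∑ i ∈ J, N l i (coeff d N x i - coeff d N x' i) * (ρ : ℝ) ^ d i) F
        (𝓝 (∑ i ∈ J, N l i (coeff d N x i - y i) * (ρ : ℝ) ^ d i)) := by
      refine tendsto_finsetSum _ fun i _ => ?_
      have h1 : Tendsto (fun x' : WeightedSum d N => coeff d N x' i) F (𝓝 (y i)) := hy i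
      exact ((((hN i).continuous_seminorm l).tendsto _).comp
        (tendsto_const_nhds.sub h1)).mul_const _
    refine le_of_tendsto hlim ?_
    filter_upwards [hS] with x' hx'
    have h1 : norm d N l ρ (x - x') < ε := hSV (Set.mk_mem_prod hx hx')
    refine le_trans ?_ h1.le
    refine ((summable d N (x - x') l ρ.2).sum_le_tsum J fun i _ => term_nonneg l ρ _ i).trans_eq' ?_
    simp
  have hmem : ∀ (l : Λ) (ρ : ℝ), 0 < ρ → Summable fun i => N l i (y i) * ρ ^ d i := by
    intro l ρ hρ
    obtain ⟨S, hS, h⟩ := key l ⟨ρ, hρ⟩ 1 one_pos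
    obtain ⟨x, hx⟩ := hFne.nonempty_of_mem hS
    have h1 : Summable fun i => N l i (coeff d N x i - y i) * ρ ^ d i :=
      summable_of_sum_le (fun i => term_nonneg (N := N) l ⟨ρ, hρ⟩ (fun i => coeff d N x i - y i) i)
        (h x hx)
    refine Summable.of_nonneg_of_le (fun i => term_nonneg (N := N) l ⟨ρ, hρ⟩ y i) (fun i => ?_)
      ((summable d N x l hρ).add h1)
    rw [← add_mul]
    refine mul_le_mul_of_nonneg_right ?_ (by positivity)
    have := map_sub_le_add (N l i) (coeff d N x i) (coeff d N x i - y i)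
    simpa using this
  refine ⟨mk y hmem, ?_⟩
  change Tendsto id F _
  refine ((withSeminorms d N).tendsto_nhds _ _).2 fun ⟨l, ρ⟩ ε hε => ?_
  obtain ⟨S, hS, h⟩ := key l ρ (ε / 2) (half_pos hε)
  filter_upwards [hS] with x hx
  refine lt_of_le_of_lt ?_ (half_lt_self hε)
  change norm d N l ρ _ ≤ _
  refine Real.tsum_le_of_sum_le (fun i => term_nonneg l ρ _ i) fun J => ?_
  exact h x hx J

/-! ### Extension of bounded families of linear maps. -/

section Lift

theorem summable_seminorm_lift {Y κ : Type*} [AddCommGroup Y] [Module ℂ Y]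
    {Q : κ → Seminorm ℂ Y} (T : ∀ i, E i →ₗ[ℂ] Y)
    (hT : ∀ k, ∃ (l : Λ) (ρ : Set.Ioi (0 : ℝ)) (C : ℝ), ∀ i e,
      Q k (T i e) ≤ C * (N l i e * (ρ : ℝ) ^ d i)) (x : WeightedSum d N) (k : κ) :
    Summable fun i => Q k (T i (coeff d N x i)) := by
  obtain ⟨l, ρ, C, h⟩ := hT k
  exact Summable.of_nonneg_of_le (fun i => apply_nonneg _ _) (fun i => h i _)
    ((summable d N x l ρ.2).mul_left C)

theorem summable_lift {Y κ : Type*} [AddCommGroup Y] [Module ℂ Y] [UniformSpace Y]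
    [IsUniformAddGroup Y] [CompleteSpace Y] {Q : κ → Seminorm ℂ Y} (hQ : WithSeminorms Q)
    (T : ∀ i, E i →ₗ[ℂ] Y)
    (hT : ∀ k, ∃ (l : Λ) (ρ : Set.Ioi (0 : ℝ)) (C : ℝ), ∀ i e,
      Q k (T i e) ≤ C * (N l i e * (ρ : ℝ) ^ d i)) (x : WeightedSum d N) :
    Summable fun i => T i (coeff d N x i) :=
  summable_of_summable_seminorm hQ (summable_seminorm_lift T hT x)

variable {Y κ : Type*} [AddCommGroup Y] [Module ℂ Y] [UniformSpace Y] [IsUniformAddGroup Y]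
  [CompleteSpace Y] [T2Space Y] {Q : κ → Seminorm ℂ Y} (hQ : WithSeminorms Q)
  (T : ∀ i, E i →ₗ[ℂ] Y)
  (hT : ∀ k, ∃ (l : Λ) (ρ : Set.Ioi (0 : ℝ)) (C : ℝ), ∀ i e,
    Q k (T i e) ≤ C * (N l i e * (ρ : ℝ) ^ d i))

/-- The extension of a bounded family of linear maps to the weighted sum. -/
def lift : WeightedSum d N →ₗ[ℂ] Y where
  toFun x := ∑' i, T i (coeff d N x i)
  map_add' x y := by
    rw [← (summable_lift hQ T hT x).tsum_add (summable_lift hQ T hT y)]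
    simp
  map_smul' c x := by
    have := hQ.continuousSMul
    simp only [map_smul, Pi.smul_apply, RingHom.id_apply]
    exact (summable_lift hQ T hT x).tsum_const_smul c

theorem lift_single [DecidableEq I] (i : I) (e : E i) :
    lift hQ T hT (single d N i e) = T i e := by
  change ∑' j, T j (coeff d N (single d N i e) j) = _
  rw [tsum_eq_single i fun j hj => by simp [coeff_single, hj]]
  simp [coeff_single]

theorem seminorm_lift_le_tsum (x : WeightedSum d N) (k : κ) :
    Q k (lift hQ T hT x) ≤ ∑' i, Q k (T i (coeff d N x i)) :=
  seminorm_tsum_le (hQ.continuous_seminorm k) (summable_lift hQ T hT x)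
    (summable_seminorm_lift T hT x k)

theorem seminorm_lift_le {k : κ} {l : Λ} {ρ : Set.Ioi (0 : ℝ)} {C : ℝ}
    (h : ∀ i e, Q k (T i e) ≤ C * (N l i e * (ρ : ℝ) ^ d i)) (x : WeightedSum d N) :
    Q k (lift hQ T hT x) ≤ C * norm d N l ρ x := by
  refine (seminorm_lift_le_tsum hQ T hT x k).trans ?_
  rw [norm_apply, ← tsum_mul_left]
  exact (summable_seminorm_lift T hT x k).tsum_le_tsum (fun i => h i _)
    ((summable d N x l ρ.2).mul_left C)

theorem continuous_lift : Continuous (lift hQ T hT) := by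
  refine continuous_of_seminorm_bound hQ _ fun k => ?_
  obtain ⟨l, ρ, C, h⟩ := hT k
  exact ⟨norm d N l ρ, continuous_norm d N l ρ, C, seminorm_lift_le hQ T hT h⟩

end Lift

/-! ### Comparison of weights. -/

section Change

variable {Λ' : Type*} (N' : Λ' → ∀ i, Seminorm ℂ (E i))

/-- One family of weights dominates another one, up to factors growing geometrically with the
degree. -/
def Dominates (d : I → ℕ) (N : Λ → ∀ i, Seminorm ℂ (E i)) (N' : Λ' → ∀ i, Seminorm ℂ (E i)) :
    Prop :=
  ∀ k, ∃ l, ∃ C : ℝ, 0 ≤ C ∧ ∃ K : Set.Ioi (0 : ℝ), ∀ i e, N' k i e ≤ C * (K : ℝ) ^ d i * N l i e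

variable {N'}

/-- A geometric factor `K ^ d i` costs nothing because every radius is allowed: replace `ρ` by `K *
ρ`. -/
theorem exists_change_bound (h : Dominates d N N') (k : Λ') (ρ : Set.Ioi (0 : ℝ)) :
    ∃ (l : Λ) (σ : Set.Ioi (0 : ℝ)) (C : ℝ), ∀ (i : I) (e : E i),
      N' k i e * (ρ : ℝ) ^ d i ≤ C * (N l i e * (σ : ℝ) ^ d i) := by
  obtain ⟨l, C, -, K, hK⟩ := h k
  have hK0 : (0 : ℝ) < K := K.2
  have hρ0 : (0 : ℝ) < ρ := ρ.2
  refine ⟨l, ⟨K * ρ, mul_pos hK0 hρ0⟩, C, fun i e => ?_⟩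
  refine (mul_le_mul_of_nonneg_right (hK i e) (pow_nonneg hρ0.le _)).trans_eq ?_
  rw [mul_pow]
  ring

variable (h : Dominates d N N')

/-- The identity map between weighted sums with comparable weights. -/
def change : WeightedSum d N →ₗ[ℂ] WeightedSum d N' where
  toFun x := mk (coeff d N x) fun k ρ hρ => by
    obtain ⟨l, σ, C, hC⟩ := exists_change_bound h k ⟨ρ, hρ⟩
    exact Summable.of_nonneg_of_le (fun i => term_nonneg (N := N') k ⟨ρ, hρ⟩ _ i)
      (fun i => hC i _) ((summable d N x l σ.2).mul_left C)
  map_add' x y := by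
    refine ext fun i => ?_
    simp
  map_smul' c x := by
    refine ext fun i => ?_
    simp

theorem continuous_change : Continuous (change h) := by
  refine continuous_of_seminorm_bound (withSeminorms d N') _ fun ⟨k, ρ⟩ => ?_
  obtain ⟨l, σ, C, hC⟩ := exists_change_bound h k ρ
  refine ⟨norm d N l σ, continuous_norm d N l σ, C, fun x => ?_⟩
  change norm d N' k ρ _ ≤ _
  rw [norm_apply, norm_apply, ← tsum_mul_left]
  exact (summable d N' (change h x) k ρ.2).tsum_le_tsum (fun i => hC i _)
    ((summable d N x l σ.2).mul_left C)

/-- The identity map between weighted sums with equivalent weights. -/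
def changeEquiv (h' : Dominates d N' N) : WeightedSum d N ≃L[ℂ] WeightedSum d N' where
  toLinearMap := change h
  invFun := change h'
  left_inv _ := rfl
  right_inv _ := rfl
  continuous_toFun := continuous_change h
  continuous_invFun := continuous_change h'

end Change

end WeightedSum

/-! ### Words -/

section Words

/-- The exponent of `α` attached to a letter. -/
def letterExp (i : Fin 2) : ℤ := if i = 0 then 1 else -1

/-- The sum of the exponents of all letters of a word. -/
def wordExp {n : ℕ} (w : Fin n → Fin 2) : ℤ := ∑ j, letterExp (w j)

theorem partialExp_append_left {m n : ℕ} (w : Fin m → Fin 2) (v : Fin n → Fin 2) (k : Fin m) :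
    partialExp (Fin.append w v) (Fin.castAdd n k) = partialExp w k := by
  have h : ∀ j : Fin n, ¬ Fin.natAdd m j < Fin.castAdd n k := fun j => by
    rw [Fin.lt_def, Fin.val_natAdd, Fin.val_castAdd]
    omega
  have h' : ∀ j : Fin m, Fin.castAdd n j < Fin.castAdd n k ↔ j < k := fun j => Iff.rfl
  simp only [partialExp, Fin.sum_univ_add, Fin.append_left, h, h', if_false, Finset.sum_const_zero,
    add_zero]

theorem partialExp_append_right {m n : ℕ} (w : Fin m → Fin 2) (v : Fin n → Fin 2) (k : Fin n) :
    partialExp (Fin.append w v) (Fin.natAdd m k) = wordExp w + partialExp v k := by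
  have h : ∀ j : Fin m, Fin.castAdd n j < Fin.natAdd m k := fun j => by
    rw [Fin.lt_def, Fin.val_natAdd, Fin.val_castAdd]
    omega
  have h' : ∀ j : Fin n, Fin.natAdd m j < Fin.natAdd m k ↔ j < k := fun j => by
    rw [Fin.lt_def, Fin.lt_def, Fin.val_natAdd, Fin.val_natAdd]
    omega
  simp only [partialExp, wordExp, letterExp, Fin.sum_univ_add, Fin.append_left, Fin.append_right, h,
    h', if_true]

theorem partialExp_zero {n : ℕ} (w : Fin (n + 1) → Fin 2) : partialExp w 0 = 0 := by
  simp [partialExp]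

theorem partialExp_succ {n : ℕ} (w : Fin (n + 1) → Fin 2) (k : Fin n) :
    partialExp w k.succ = letterExp (w 0) + partialExp (fun j => w j.succ) k := by
  simp [partialExp, letterExp, Fin.sum_univ_succ]

theorem wordExp_append {m n : ℕ} (w : Fin m → Fin 2) (v : Fin n → Fin 2) :
    wordExp (Fin.append w v) = wordExp w + wordExp v := by
  simp [wordExp, Fin.sum_univ_add]

theorem wordExp_succ {n : ℕ} (w : Fin (n + 1) → Fin 2) :
    wordExp w = letterExp (w 0) + wordExp fun j => w j.succ := by
  simp [wordExp, Fin.sum_univ_succ]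

namespace Word

/-- The empty word. -/
def nil : Word := ⟨0, Fin.elim0⟩

/-- Concatenation of words. -/
def append (w v : Word) : Word := ⟨w.1 + v.1, Fin.append w.2 v.2⟩

/-- The sum of the exponents of all letters of a word. -/
def exp (w : Word) : ℤ := wordExp w.2

theorem exp_append (w v : Word) : (w.append v).exp = w.exp + v.exp := wordExp_append _ _

theorem exp_nil : nil.exp = 0 := Fin.sum_univ_zero (fun j => letterExp (nil.2 j))

theorem eq_nil (w : Fin 0 → Fin 2) : (⟨0, w⟩ : Word) = nil := by
  rw [nil, Subsingleton.elim w]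

theorem nil_append (w : Word) : nil.append w = w :=
  Fin.sigma_eq_of_eq_comp_cast (Nat.zero_add _) (Fin.elim0_append _)

theorem append_nil (w : Word) : w.append nil = w :=
  Fin.sigma_eq_of_eq_comp_cast (Nat.add_zero _) (Fin.append_elim0 _)

theorem append_assoc (u v w : Word) : (u.append v).append w = u.append (v.append w) :=
  Fin.sigma_eq_of_eq_comp_cast (Nat.add_assoc _ _ _) (Fin.append_assoc _ _ _)

end Word

variable {A : Type*} [Ring A] [Algebra ℂ A] (α : A ≃ₐ[ℂ] A)

theorem zpow_add_apply (m n : ℤ) (a : A) :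
    (α ^ (m + n) : A ≃ₐ[ℂ] A) a = (α ^ m : A ≃ₐ[ℂ] A) ((α ^ n : A ≃ₐ[ℂ] A) a) := by
  rw [zpow_add]
  rfl

theorem zpow_zero_apply (a : A) : (α ^ (0 : ℤ) : A ≃ₐ[ℂ] A) a = a := by
  rw [zpow_zero]
  rfl

theorem wordMap_apply {n : ℕ} (w : Fin n → Fin 2) (x : Fin n → A) :
    wordMap α w x = (List.ofFn fun k => (α ^ partialExp w k : A ≃ₐ[ℂ] A) (x k)).prod :=
  MultilinearMap.mkPiAlgebraFin_apply (R := ℂ) (A := A) _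

/-- All exponents after the first place contain the exponent of the first letter, so one
automorphism factors out of the remaining product. Inductions on words rest on this recursion. -/
theorem wordMap_succ {n : ℕ} (w : Fin (n + 1) → Fin 2) (x : Fin (n + 1) → A) :
    wordMap α w x = x 0 * (α ^ letterExp (w 0) : A ≃ₐ[ℂ] A)
      (wordMap α (fun j => w j.succ) fun j => x j.succ) := by
  rw [wordMap_apply, wordMap_apply, List.ofFn_succ, List.prod_cons, partialExp_zero,
    zpow_zero_apply, map_list_prod, List.map_ofFn]
  simp only [partialExp_succ, zpow_add_apply]
  rfl

/-- The exponents in the second block are those of `v` shifted by the total exponent of `w`. This is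
the source of both the product formula for monomials and its seminorm estimate. -/
theorem wordMap_append {m n : ℕ} (w : Fin m → Fin 2) (v : Fin n → Fin 2) (x : Fin m → A)
    (y : Fin n → A) :
    wordMap α (Fin.append w v) (Fin.append x y) =
      wordMap α w x * (α ^ wordExp w : A ≃ₐ[ℂ] A) (wordMap α v y) := by
  rw [wordMap_apply, wordMap_apply, wordMap_apply, map_list_prod, List.map_ofFn,
    ← List.prod_append, ← List.ofFn_fin_append]
  congr 2
  funext k
  induction k using Fin.addCases with
  | left i => rw [partialExp_append_left, Fin.append_left, Fin.append_left]
  | right i =>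
    rw [partialExp_append_right, Fin.append_right, Fin.append_right, zpow_add_apply]
    rfl

theorem wordMap_cons_one {n : ℕ} (w : Fin (n + 1) → Fin 2) (a : A) :
    wordMap α w (Fin.cons a fun _ => 1) = a := by
  rw [wordMap_succ]
  have : (wordMap α (fun j => w j.succ)) (fun j : Fin n => (1 : A)) = 1 := by
    simp [wordMap_apply]
  simp [this]

theorem wordMap_update_zero {n : ℕ} (w : Fin (n + 1) → Fin 2) (a : A) (x : Fin (n + 1) → A) :
    wordMap α w (Function.update x 0 (a * x 0)) = a * wordMap α w x := by
  rw [wordMap_succ, wordMap_succ α w x]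
  simp [mul_assoc]

/-- The last entry is twisted only by the letters before it. The last letter, missing from the total
exponent, has to be applied to `b` beforehand. -/
theorem wordMap_update_last {n : ℕ} (w : Fin (n + 1) → Fin 2) (b : A) (x : Fin (n + 1) → A) :
    wordMap α w (Function.update x (Fin.last n)
      (x (Fin.last n) * (α ^ letterExp (w (Fin.last n)) : A ≃ₐ[ℂ] A) b)) =
      wordMap α w x * (α ^ wordExp w : A ≃ₐ[ℂ] A) b := by
  induction n with
  | zero =>
    rw [wordMap_succ, wordMap_succ α w x]
    simp [wordMap_apply, wordExp]
  | succ n ih =>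
    rw [wordMap_succ, wordMap_succ α w x, wordExp_succ, zpow_add_apply, mul_assoc, ← map_mul]
    have h : ∀ c : A, (fun j : Fin (n + 1) => Function.update x (Fin.last (n + 1)) c j.succ) =
        Function.update (fun j => x j.succ) (Fin.last n) c := by
      intro c
      funext j
      by_cases hj : j = Fin.last n
      · subst hj
        rw [Fin.succ_last, Function.update_self, Function.update_self]
      · rw [Function.update_of_ne hj, Function.update_of_ne]
        rw [← Fin.succ_last]
        exact fun h => hj (Fin.succ_injective _ h)
    rw [h, Function.update_of_ne (by simp [Fin.ext_iff]),
      ← ih (fun j => w j.succ) (fun j => x j.succ)]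
    rfl

end Words

/-! ### Arens-Michael algebras -/

section ArensMichael

open Topology

variable {X Y : Type*} [AddCommGroup X] [Module ℂ X] [AddCommGroup Y] [Module ℂ Y]

theorem IsArensMichael.of_family [UniformSpace X] [IsUniformAddGroup X] [T2Space X]
    [CompleteSpace X] {κ : Type*} {P : κ → Seminorm ℂ X} (hP : WithSeminorms P) {mul : X → X → X}
    (h : ∀ k x y, P k (mul x y) ≤ P k x * P k y) : IsArensMichael X mul where
  isUniformAddGroup := inferInstance
  t2Space := inferInstance
  completeSpace := inferInstance
  exists_submultiplicative := by
    refine ⟨Set.range P, ?_, ?_⟩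
    · refine withSeminorms_of_bounds hP ?_ fun l => ⟨⟨P l, l, rfl⟩, 1, fun x => (one_mul _).ge⟩
      rintro ⟨_, k, rfl⟩
      exact hP.continuous_seminorm k
    · rintro _ ⟨k, rfl⟩
      exact h k

/-- Separate continuity suffices later, since density arguments vary one factor at a time. -/
theorem IsArensMichael.continuous_right [UniformSpace X] {m : X →ₗ[ℂ] X →ₗ[ℂ] X}
    (h : IsArensMichael X fun x y => m x y) (x : X) : Continuous (m x) := by
  obtain ⟨P, hP, hm⟩ := h.exists_submultiplicative
  have := h.isUniformAddGroup
  have := hP.continuousSMul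
  exact continuous_of_seminorm_bound hP _ fun s =>
    ⟨s, hP.continuous_seminorm s, s.1 x, fun y => hm s s.2 x y⟩

theorem IsArensMichael.continuous_left [UniformSpace X] {m : X →ₗ[ℂ] X →ₗ[ℂ] X}
    (h : IsArensMichael X fun x y => m x y) (y : X) : Continuous (m.flip y) := by
  obtain ⟨P, hP, hm⟩ := h.exists_submultiplicative
  have := h.isUniformAddGroup
  have := hP.continuousSMul
  exact continuous_of_seminorm_bound hP _ fun s =>
    ⟨s, hP.continuous_seminorm s, s.1 y, fun x => (hm s s.2 x y).trans_eq (mul_comm _ _)⟩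

/-- Transport of an algebra structure along a linear equivalence. -/
def AlgStructure.transport (e : X ≃ₗ[ℂ] Y) (T : AlgStructure X) : AlgStructure Y where
  mul := (T.mul.compl₁₂ e.symm.toLinearMap e.symm.toLinearMap).compr₂ e.toLinearMap
  one := e T.one
  mul_assoc x y z := by simp [T.mul_assoc]
  one_mul x := by simp [T.one_mul]
  mul_one x := by simp [T.mul_one]

theorem AlgStructure.transport_mul (e : X ≃ₗ[ℂ] Y) (T : AlgStructure X) (x y : X) :
    (T.transport e).mul (e x) (e y) = e (T.mul x y) := by
  simp [AlgStructure.transport]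

theorem AlgStructure.transport_mul_apply (e : X ≃ₗ[ℂ] Y) (T : AlgStructure X) (x y : Y) :
    (T.transport e).mul x y = e (T.mul (e.symm x) (e.symm y)) :=
  rfl

/-- A two-sided unit is determined by the multiplication. -/
theorem AlgStructure.ext_mul {T T' : AlgStructure X} (h : ∀ x y, T.mul x y = T'.mul x y) :
    T = T' := by
  have h1 : T.one = T'.one := by
    rw [← T'.mul_one T.one, ← h, T.one_mul]
  exact AlgStructure.ext (LinearMap.ext₂ h) h1

theorem completeSpace_of_equiv [UniformSpace X] [UniformSpace Y] [IsUniformAddGroup X]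
    [IsUniformAddGroup Y] [CompleteSpace X] (e : X ≃L[ℂ] Y) : CompleteSpace Y := by
  have hu : IsUniformInducing e.symm := by
    refine ⟨le_antisymm ?_ ?_⟩
    · intro V hV
      have hc : UniformContinuous (e : X →+ Y) :=
        uniformContinuous_addMonoidHom_of_continuous e.continuous
      refine ⟨_, hc hV, fun z hz => ?_⟩
      simpa using hz
    · have hc : UniformContinuous (e.symm : Y →+ X) :=
        uniformContinuous_addMonoidHom_of_continuous e.symm.continuous
      exact Filter.map_le_iff_le_comap.1 hc
  exact (hu.completeSpace_congr e.symm.surjective).2 inferInstance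

theorem IsArensMichael.transport [UniformSpace X] [UniformSpace Y] [IsUniformAddGroup Y]
    {T : AlgStructure X} (h : IsArensMichael X fun x y => T.mul x y) (e : X ≃L[ℂ] Y) :
    IsArensMichael Y fun x y => (T.transport e.toLinearEquiv).mul x y := by
  obtain ⟨P, hP, hm⟩ := h.exists_submultiplicative
  have := h.isUniformAddGroup
  have := h.completeSpace
  have := h.t2Space
  have hs : Continuous e.symm := e.symm.continuous
  have : T2Space Y := T2Space.of_injective_continuous e.symm.injective hs
  have := completeSpace_of_equiv e
  have hi : IsInducing e.symm := e.symm.toHomeomorph.isInducing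
  refine IsArensMichael.of_family (P := fun s : P => s.1.comp e.symm.toLinearMap)
    (hi.withSeminorms (f := e.symm.toLinearMap) hP) fun s x y => ?_
  simpa [AlgStructure.transport_mul_apply] using hm s s.2 (e.symm x) (e.symm y)

end ArensMichael

/-! ### Weighted sums as algebras -/

namespace WeightedSum

section Algebra

variable {I Λ A : Type*} [AddCommGroup A] [Module ℂ A] [DecidableEq I]
  {d : I → ℕ} {N : Λ → I → Seminorm ℂ A}

/-- A bilinear product of the homogeneous components that is compatible with the weights. -/
structure GradedProduct (d : I → ℕ) (N : Λ → I → Seminorm ℂ A) where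
  op : I → I → I
  coeffMul : I → I → A →ₗ[ℂ] A →ₗ[ℂ] A
  degree_op : ∀ i j, d (op i j) = d i + d j
  le_mul : ∀ l i j a b, N l (op i j) (coeffMul i j a b) ≤ N l i a * N l j b

variable (G : GradedProduct d N)

namespace GradedProduct

/-- The product `b ↦ (a x^i) (b x^j)`. -/
def singleMul (i : I) (a : A) (j : I) : A →ₗ[ℂ] WeightedSum (E := fun _ : I => A) d N :=
  (single (E := fun _ : I => A) d N (G.op i j)).comp (G.coeffMul i j a)

theorem norm_singleMul_le (i : I) (a : A) (l : Λ) (ρ : Set.Ioi (0 : ℝ)) (j : I) (b : A) :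
    norm d N l ρ (G.singleMul i a j b) ≤
      N l i a * (ρ : ℝ) ^ d i * (N l j b * (ρ : ℝ) ^ d j) := by
  have hρ : (0 : ℝ) < ρ := ρ.2
  refine (norm_single (E := fun _ : I => A) l ρ _ _).trans_le ?_
  rw [G.degree_op, pow_add]
  refine (mul_le_mul_of_nonneg_right (G.le_mul l i j a b) (by positivity)).trans_eq ?_
  ring

theorem exists_singleMul_bound (i : I) (a : A) (k : Λ × Set.Ioi (0 : ℝ)) :
    ∃ (l : Λ) (ρ : Set.Ioi (0 : ℝ)) (C : ℝ), ∀ j b,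
      norm d N k.1 k.2 (G.singleMul i a j b) ≤ C * (N l j b * (ρ : ℝ) ^ d j) :=
  ⟨k.1, k.2, _, G.norm_singleMul_le i a k.1 k.2⟩

variable [CompleteSpace (WeightedSum (E := fun _ : I => A) d N)]
  [T2Space (WeightedSum (E := fun _ : I => A) d N)]

/-- Left multiplication by `a x^i`. -/
def mulLeftSingle (i : I) : A →ₗ[ℂ] WeightedSum (E := fun _ : I => A) d N →ₗ[ℂ]
    WeightedSum (E := fun _ : I => A) d N :=
  have hc := fun a => continuous_lift (withSeminorms d N) (G.singleMul i a)
    (G.exists_singleMul_bound i a)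
  { toFun := fun a => lift (withSeminorms d N) (G.singleMul i a) (G.exists_singleMul_bound i a)
    map_add' := fun a b => by
      refine linearMap_ext (hc _) ((hc a).add (hc b)) fun j e => ?_
      rw [LinearMap.add_apply, lift_single, lift_single, lift_single]
      simp [singleMul]
    map_smul' := fun c a => by
      refine linearMap_ext (hc _) ((hc a).const_smul c) fun j e => ?_
      rw [LinearMap.smul_apply, lift_single, lift_single]
      simp [singleMul] }

theorem mulLeftSingle_single (i : I) (a : A) (j : I) (b : A) :
    G.mulLeftSingle i a (single (E := fun _ : I => A) d N j b) =
      single (E := fun _ : I => A) d N (G.op i j) (G.coeffMul i j a b) :=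
  lift_single (withSeminorms d N) _ (G.exists_singleMul_bound i a) _ _

theorem norm_mulLeftSingle_le (l : Λ) (ρ : Set.Ioi (0 : ℝ)) (i : I) (a : A)
    (y : WeightedSum (E := fun _ : I => A) d N) :
    norm d N l ρ (G.mulLeftSingle i a y) ≤ norm d N l ρ y * (N l i a * (ρ : ℝ) ^ d i) := by
  rw [mul_comm]
  exact seminorm_lift_le (k := (l, ρ)) (withSeminorms d N) _ (G.exists_singleMul_bound i a)
    (G.norm_singleMul_le i a l ρ) y

theorem exists_mulLeftSingle_bound (y : WeightedSum (E := fun _ : I => A) d N)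
    (k : Λ × Set.Ioi (0 : ℝ)) : ∃ (l : Λ) (ρ : Set.Ioi (0 : ℝ)) (C : ℝ), ∀ i a,
      norm d N k.1 k.2 ((G.mulLeftSingle i).flip y a) ≤ C * (N l i a * (ρ : ℝ) ^ d i) :=
  ⟨k.1, k.2, _, fun i a => G.norm_mulLeftSingle_le k.1 k.2 i a y⟩

/-- The multiplication of a weighted sum. -/
def mul : WeightedSum (E := fun _ : I => A) d N →ₗ[ℂ]
    WeightedSum (E := fun _ : I => A) d N →ₗ[ℂ] WeightedSum (E := fun _ : I => A) d N :=
  have hc := fun y => continuous_lift (withSeminorms d N) (fun i => (G.mulLeftSingle i).flip y)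
    (G.exists_mulLeftSingle_bound y)
  -- The lift extends in the left factor with `y` fixed, so `y` comes out as the first argument.
  LinearMap.flip
  { toFun := fun y => lift (withSeminorms d N) (fun i => (G.mulLeftSingle i).flip y)
      (G.exists_mulLeftSingle_bound y)
    map_add' := fun y z => by
      refine linearMap_ext (hc _) ((hc y).add (hc z)) fun j e => ?_
      rw [LinearMap.add_apply, lift_single, lift_single, lift_single]
      simp
    map_smul' := fun c y => by
      refine linearMap_ext (hc _) ((hc y).const_smul c) fun j e => ?_
      rw [LinearMap.smul_apply, lift_single, lift_single]
      simp }

theorem mul_single_left (i : I) (a : A) (y : WeightedSum (E := fun _ : I => A) d N) :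
    G.mul (single (E := fun _ : I => A) d N i a) y = G.mulLeftSingle i a y :=
  lift_single (withSeminorms d N) (fun i => (G.mulLeftSingle i).flip y)
    (G.exists_mulLeftSingle_bound y) _ _

theorem mul_single_single (i : I) (a : A) (j : I) (b : A) :
    G.mul (single (E := fun _ : I => A) d N i a) (single (E := fun _ : I => A) d N j b) =
      single (E := fun _ : I => A) d N (G.op i j) (G.coeffMul i j a b) := by
  rw [mul_single_left, mulLeftSingle_single]

/-- The bound for right multiplication by `y` has constant exactly `norm d N l ρ y`, so extending by
continuity in each factor loses nothing. -/
theorem norm_mul_le (l : Λ) (ρ : Set.Ioi (0 : ℝ)) (x y : WeightedSum (E := fun _ : I => A) d N) :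
    norm d N l ρ (G.mul x y) ≤ norm d N l ρ x * norm d N l ρ y := by
  rw [mul_comm]
  exact seminorm_lift_le (k := (l, ρ)) (withSeminorms d N) _ (G.exists_mulLeftSingle_bound y)
    (fun i a => G.norm_mulLeftSingle_le l ρ i a y) x

attribute [irreducible] mul

theorem isArensMichael : IsArensMichael (WeightedSum (E := fun _ : I => A) d N)
    fun x y => G.mul x y :=
  .of_family (withSeminorms d N) fun k => G.norm_mul_le k.1 k.2

/-- Known on monomials, associativity is extended by density to `z`, then to `y`, then to `x`. -/
theorem mul_assoc (h : ∀ i a j b k c,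
      single (E := fun _ : I => A) d N (G.op (G.op i j) k)
        (G.coeffMul (G.op i j) k (G.coeffMul i j a b) c) =
      single (E := fun _ : I => A) d N (G.op i (G.op j k))
        (G.coeffMul i (G.op j k) a (G.coeffMul j k b c)))
    (x y z : WeightedSum (E := fun _ : I => A) d N) :
    G.mul (G.mul x y) z = G.mul x (G.mul y z) := by
  have hr := G.isArensMichael.continuous_right
  have hl := G.isArensMichael.continuous_left
  have h1 : ∀ i a j b, ∀ z, G.mul (G.mul (single (E := fun _ : I => A) d N i a)
      (single (E := fun _ : I => A) d N j b)) z = G.mul (single (E := fun _ : I => A) d N i a)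
        (G.mul (single (E := fun _ : I => A) d N j b) z) := by
    intro i a j b
    have e : G.mul (G.mul (single (E := fun _ : I => A) d N i a)
        (single (E := fun _ : I => A) d N j b)) =
          (G.mul (single (E := fun _ : I => A) d N i a)).comp
            (G.mul (single (E := fun _ : I => A) d N j b)) := by
      refine linearMap_ext (hr _) ((hr _).comp (hr _)) fun k c => ?_
      rw [LinearMap.comp_apply, mul_single_single, mul_single_single, mul_single_single,
        mul_single_single, h]
    exact fun z => LinearMap.congr_fun e z
  have h2 : ∀ i a z, ∀ y, G.mul (G.mul (single (E := fun _ : I => A) d N i a) y) z =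
      G.mul (single (E := fun _ : I => A) d N i a) (G.mul y z) := by
    intro i a z
    have e : (G.mul.flip z).comp (G.mul (single (E := fun _ : I => A) d N i a)) =
        (G.mul (single (E := fun _ : I => A) d N i a)).comp (G.mul.flip z) :=
      linearMap_ext ((hl _).comp (hr _)) ((hr _).comp (hl _)) fun j b => h1 i a j b z
    exact fun y => LinearMap.congr_fun e y
  have e : (G.mul.flip z).comp (G.mul.flip y) = G.mul.flip (G.mul y z) :=
    linearMap_ext ((hl _).comp (hl _)) (hl _) fun i a => h2 i a z y
  exact LinearMap.congr_fun e x

/-- A weighted sum as an algebra. -/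
def algStructure (o : I) (u : A) (h : ∀ i a j b k c,
      single (E := fun _ : I => A) d N (G.op (G.op i j) k)
        (G.coeffMul (G.op i j) k (G.coeffMul i j a b) c) =
      single (E := fun _ : I => A) d N (G.op i (G.op j k))
        (G.coeffMul i (G.op j k) a (G.coeffMul j k b c)))
    (hl : ∀ i a, single (E := fun _ : I => A) d N (G.op o i) (G.coeffMul o i u a) =
      single (E := fun _ : I => A) d N i a)
    (hr : ∀ i a, single (E := fun _ : I => A) d N (G.op i o) (G.coeffMul i o a u) =
      single (E := fun _ : I => A) d N i a) :
    AlgStructure (WeightedSum (E := fun _ : I => A) d N) where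
  mul := G.mul
  one := single (E := fun _ : I => A) d N o u
  mul_assoc := G.mul_assoc h
  one_mul x := by
    have e : G.mul (single (E := fun _ : I => A) d N o u) = LinearMap.id :=
      linearMap_ext (G.isArensMichael.continuous_right _) continuous_id fun i a => by
        rw [mul_single_single, hl, LinearMap.id_apply]
    exact LinearMap.congr_fun e x
  mul_one x := by
    have e : G.mul.flip (single (E := fun _ : I => A) d N o u) = LinearMap.id :=
      linearMap_ext (G.isArensMichael.continuous_left _) continuous_id fun i a => by
        rw [LinearMap.flip_apply, mul_single_single, hr, LinearMap.id_apply]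
    exact LinearMap.congr_fun e x

end GradedProduct

end Algebra

end WeightedSum

/-! ### Seminorms attached to words -/

section WordSeminorms

variable {A : Type*} [Ring A] [Algebra ℂ A]

/-- Only nonempty products are allowed: submultiplicativity does not give `r 1 ≤ 1`. -/
theorem apply_prod_ofFn_le {r : Seminorm ℂ A} (hr : ∀ x y, r (x * y) ≤ r x * r y) {n : ℕ}
    (y : Fin (n + 1) → A) : r (List.ofFn y).prod ≤ ∏ i, r (y i) := by
  induction n with
  | zero => simp
  | succ n ih =>
    rw [List.ofFn_succ, List.prod_cons, Fin.prod_univ_succ]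
    exact (hr _ _).trans (mul_le_mul_of_nonneg_left (ih _) (apply_nonneg _ _))

variable (α : A ≃ₐ[ℂ] A)

theorem continuous_zpow [TopologicalSpace A] {α : A ≃ₐ[ℂ] A} (hα : Continuous α)
    (hα' : Continuous α.symm) (z : ℤ) : Continuous (α ^ z : A ≃ₐ[ℂ] A) := by
  induction z using Int.induction_on with
  | zero =>
    rw [zpow_zero]
    exact continuous_id
  | succ n ih =>
    rw [zpow_add_one]
    exact ih.comp hα
  | pred n ih =>
    rw [zpow_sub_one]
    exact ih.comp hα'

theorem wordSeminorm_wordMap_le {n : ℕ} (s : Seminorm ℂ A) (w : Fin (n + 1) → Fin 2)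
    (x : Fin (n + 1) → A) : wordSeminorm α s ⟨n + 1, w⟩ (wordMap α w x) ≤ ∏ i, s (x i) :=
  projSeminorm_apply_le (span_wordMap α w) x

theorem le_wordSeminorm {n : ℕ} {s t : Seminorm ℂ A} {w : Fin (n + 1) → Fin 2} {C : ℝ}
    (hC : 0 ≤ C) (h : ∀ x, t (wordMap α w x) ≤ C * ∏ i, s (x i)) (a : A) :
    t a ≤ C * wordSeminorm α s ⟨n + 1, w⟩ a :=
  le_projSeminorm (span_wordMap α w) hC h a

/-- Each of the `n` entries contributes a factor `C`, whereas the empty word costs one `C` although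
its length is zero. The bound `C * C ^ w.1` covers both cases. -/
theorem wordSeminorm_mono {s t : Seminorm ℂ A} {C : ℝ} (hC : 1 ≤ C) (h : ∀ a, s a ≤ C * t a)
    (w : Word) (a : A) : wordSeminorm α s w a ≤ C * C ^ w.1 * wordSeminorm α t w a := by
  have hC0 : 0 ≤ C := zero_le_one.trans hC
  obtain ⟨n, w⟩ := w
  cases n with
  | zero =>
    rw [pow_zero, mul_one]
    exact h a
  | succ n =>
    have h1 : wordSeminorm α s ⟨n + 1, w⟩ a ≤ C ^ (n + 1) * wordSeminorm α t ⟨n + 1, w⟩ a := by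
      refine le_wordSeminorm α (pow_nonneg hC0 _) (fun x => ?_) a
      refine (wordSeminorm_wordMap_le α s w x).trans ?_
      refine (Finset.prod_le_prod (fun i _ => apply_nonneg s _) fun i _ => h (x i)).trans_eq ?_
      simp [Finset.prod_mul_distrib]
    refine h1.trans (mul_le_mul_of_nonneg_right ?_ (apply_nonneg _ _))
    exact le_mul_of_one_le_left (pow_nonneg hC0 _) hC

theorem continuous_wordSeminorm [TopologicalSpace A] [IsTopologicalAddGroup A]
    [ContinuousConstSMul ℂ A] {s : Seminorm ℂ A} (hs : Continuous s) (w : Word) :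
    Continuous (wordSeminorm α s w) := by
  obtain ⟨n, w⟩ := w
  cases n with
  | zero => exact hs
  | succ n =>
    -- The representation `a = i_w(a, 1, …, 1)` bounds the word seminorm of `a` by `s a * s 1 ^ n`.
    let c : NNReal := ⟨s 1 ^ n, pow_nonneg (apply_nonneg s _) n⟩
    have hc : Continuous (c • s : Seminorm ℂ A) :=
      continuous_const.mul hs
    refine Seminorm.continuous_of_le hc fun a => ?_
    have := wordSeminorm_wordMap_le α s w (Fin.cons a fun _ => 1)
    rw [wordMap_cons_one] at this
    refine this.trans_eq ?_
    rw [Fin.prod_univ_succ]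
    simp only [Fin.cons_zero, Fin.cons_succ, Finset.prod_const, Finset.card_univ, Fintype.card_fin]
    exact mul_comm _ _

/-- The continuous submultiplicative seminorms of a topological algebra. -/
def SubmultSeminorm (A : Type*) [Ring A] [Algebra ℂ A] [TopologicalSpace A] : Type _ :=
  {r : Seminorm ℂ A // Continuous r ∧ ∀ x y, r (x * y) ≤ r x * r y}

variable [UniformSpace A]

theorem withSeminorms_submult (hA : IsArensMichael A fun a b => a * b) :
    WithSeminorms fun r : SubmultSeminorm A => r.1 := by
  obtain ⟨P, hP, hm⟩ := hA.exists_submultiplicative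
  exact withSeminorms_of_bounds hP (fun r => r.2.1) fun l =>
    ⟨⟨l.1, hP.continuous_seminorm l, hm l.1 l.2⟩, 1, fun x => (one_mul _).ge⟩

/-- A generating submultiplicative family need not be directed. The family of all continuous
submultiplicative seminorms is, because it is closed under maxima. -/
theorem isDirectedFamily_submult : IsDirectedFamily fun r : SubmultSeminorm A => r.1 := by
  refine ⟨⟨⟨0, continuous_const, fun x y => ?_⟩⟩, fun r r' =>
    ⟨⟨r.1 ⊔ r'.1, ?_, fun x y => ?_⟩, 1, fun x => ?_⟩⟩
  · simp
  · exact r.2.1.max r'.2.1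
  · simp only [Seminorm.sup_apply]
    refine max_le ((r.2.2 x y).trans ?_) ((r'.2.2 x y).trans ?_)
    · exact mul_le_mul (le_max_left _ _) (le_max_left _ _) (apply_nonneg _ _)
        ((apply_nonneg r.1 x).trans (le_max_left _ _))
    · exact mul_le_mul (le_max_right _ _) (le_max_right _ _) (apply_nonneg _ _)
        ((apply_nonneg r.1 x).trans (le_max_left _ _))
  · simp only [Seminorm.sup_apply, one_mul]
    exact ⟨le_max_left _ _, le_max_right _ _⟩

variable {α}

/-- Joint continuity of `i_w`. The seminorm and the constant may depend on `w`: no uniform control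
of the powers of `α` is available, and none is needed to identify the topology word by word. -/
theorem exists_bound_wordMap (hA : IsArensMichael A fun a b => a * b) (hα : Continuous α)
    (hα' : Continuous α.symm) {Λ : Type*} {p : Λ → Seminorm ℂ A} (hp : WithSeminorms p)
    (hpd : IsDirectedFamily p) {s : Seminorm ℂ A} (hs : Continuous s) {n : ℕ}
    (w : Fin (n + 1) → Fin 2) :
    ∃ l, ∃ C : ℝ, 0 ≤ C ∧ ∀ x, s (wordMap α w x) ≤ C * ∏ i, p l (x i) := by
  have := hA.isUniformAddGroup
  have := hp.continuousSMul
  obtain ⟨r, C, hC, hr⟩ := exists_bound_of_directed (withSeminorms_submult hA)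
    isDirectedFamily_submult hs
  -- One continuous seminorm dominating `r` after each of the finitely many twists that occur in
  -- `i_w`.
  let t : Seminorm ℂ A := Finset.univ.sup fun i =>
    r.1.comp (α ^ partialExp w i : A ≃ₐ[ℂ] A).toLinearMap
  have ht : Continuous t :=
    Seminorm.continuous_finsetSup fun i _ => r.2.1.comp (continuous_zpow hα hα' _)
  obtain ⟨l, D, hD, hl⟩ := exists_bound_of_directed hp hpd ht
  have hC0 : 0 ≤ C := zero_le_one.trans hC
  refine ⟨l, C * D ^ (n + 1), by positivity, fun x => (hr _).trans ?_⟩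
  rw [mul_assoc]
  refine mul_le_mul_of_nonneg_left ?_ hC0
  rw [wordMap_apply]
  refine (apply_prod_ofFn_le r.2.2 _).trans ?_
  refine (Finset.prod_le_prod (fun i _ => apply_nonneg _ _)
    fun i _ => (le_trans ?_ (hl (x i)) : _ ≤ D * p l (x i))).trans_eq ?_
  · exact Seminorm.le_finset_sup_apply (p := fun i =>
      r.1.comp (α ^ partialExp w i : A ≃ₐ[ℂ] A).toLinearMap) (Finset.mem_univ i)
  · simp [Finset.prod_mul_distrib]

/-- Each coefficient space keeps the complete Hausdorff topology of `A`; completeness of the space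
of series and of the tensor powers depends on this. -/
theorem withSeminorms_wordSeminorm (hA : IsArensMichael A fun a b => a * b) (hα : Continuous α)
    (hα' : Continuous α.symm) {Λ : Type*} {p : Λ → Seminorm ℂ A} (hp : WithSeminorms p)
    (hpd : IsDirectedFamily p) (w : Word) : WithSeminorms fun l => wordSeminorm α (p l) w := by
  have := hA.isUniformAddGroup
  have := hp.continuousSMul
  obtain ⟨n, w⟩ := w
  cases n with
  | zero => exact hp
  | succ n =>
    refine withSeminorms_of_bounds hp
      (fun l => continuous_wordSeminorm α (hp.continuous_seminorm l) _) fun l => ?_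
    obtain ⟨k, C, hC, h⟩ := exists_bound_wordMap hA hα hα' hp hpd (hp.continuous_seminorm l) w
    exact ⟨k, C, le_wordSeminorm α hC h⟩

end WordSeminorms

/-! ### Submultiplicative families of word seminorms -/

section TwistedWordSeminorms

variable {A : Type*} [Ring A] [Algebra ℂ A] (α : A ≃ₐ[ℂ] A)

/-- The maximum of a seminorm and of its translates under `α` and `α⁻¹`. -/
def twistSup (r : Seminorm ℂ A) : Seminorm ℂ A :=
  r ⊔ (r.comp α.toLinearMap ⊔ r.comp α.symm.toLinearMap)

theorem le_twistSup (r : Seminorm ℂ A) (a : A) : r a ≤ twistSup α r a :=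
  le_max_left _ _

theorem zpow_letterExp_le_twistSup (r : Seminorm ℂ A) (i : Fin 2) (a : A) :
    r ((α ^ letterExp i : A ≃ₐ[ℂ] A) a) ≤ twistSup α r a := by
  unfold letterExp
  split_ifs
  · rw [zpow_one]
    exact (le_max_left _ _).trans (le_max_right _ _)
  · rw [zpow_neg_one]
    exact (le_max_right _ _).trans (le_max_right _ _)

theorem continuous_twistSup [TopologicalSpace A] {α : A ≃ₐ[ℂ] A} (hα : Continuous α)
    (hα' : Continuous α.symm) {r : Seminorm ℂ A} (hr : Continuous r) : Continuous (twistSup α r) :=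
  hr.max ((hr.comp hα).max (hr.comp hα'))

theorem twistSup_mul_le {r : Seminorm ℂ A} (hr : ∀ x y, r (x * y) ≤ r x * r y) (a b : A) :
    twistSup α r (a * b) ≤ twistSup α r a * twistSup α r b := by
  have h : ∀ f : A →ₐ[ℂ] A, (∀ x, r (f x) ≤ twistSup α r x) →
      r (f (a * b)) ≤ twistSup α r a * twistSup α r b := fun f hf => by
    rw [map_mul]
    exact (hr _ _).trans (mul_le_mul (hf a) (hf b) (apply_nonneg _ _) (apply_nonneg _ _))
  refine max_le (h (AlgHom.id ℂ A) (le_twistSup α r))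
    (max_le (h α fun x => ?_) (h α.symm fun x => ?_))
  · exact (le_max_left _ _).trans (le_max_right _ _)
  · exact (le_max_right _ _).trans (le_max_right _ _)

/-- The word seminorms, modified for the empty word so that they become compatible with the
multiplication of skew power series. -/
def twistedWordSeminorm (r : Seminorm ℂ A) : Word → Seminorm ℂ A
  | ⟨0, _⟩ => twistSup α r
  | ⟨n + 1, w⟩ => wordSeminorm α r ⟨n + 1, w⟩

theorem wordSeminorm_le_twisted (r : Seminorm ℂ A) (w : Word) (a : A) :
    wordSeminorm α r w a ≤ twistedWordSeminorm α r w a := by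
  obtain ⟨n, w⟩ := w
  cases n with
  | zero => exact le_twistSup α r a
  | succ n => exact le_rfl

/-- Together with `wordSeminorm_le_twisted` this sandwiches the modified seminorms between word
seminorms, so they will define the same space of series. -/
theorem twisted_le_wordSeminorm (r : Seminorm ℂ A) (w : Word) (a : A) :
    twistedWordSeminorm α r w a ≤ wordSeminorm α (twistSup α r) w a := by
  obtain ⟨n, w⟩ := w
  cases n with
  | zero => exact le_rfl
  | succ n =>
    rw [← one_mul (wordSeminorm α _ _ _)]
    refine le_wordSeminorm α zero_le_one (fun x => ?_) a
    rw [one_mul]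
    exact (wordSeminorm_wordMap_le α r w x).trans
      (Finset.prod_le_prod (fun i _ => apply_nonneg _ _) fun i _ => le_twistSup α r _)

theorem continuous_twistedWordSeminorm [TopologicalSpace A] {α : A ≃ₐ[ℂ] A}
    [IsTopologicalAddGroup A] [ContinuousConstSMul ℂ A] (hα : Continuous α)
    (hα' : Continuous α.symm) {r : Seminorm ℂ A} (hr : Continuous r) (w : Word) :
    Continuous (twistedWordSeminorm α r w) :=
  Seminorm.continuous_of_le (continuous_wordSeminorm α (continuous_twistSup hα hα' hr) w)
    (twisted_le_wordSeminorm α r w)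

/-- The product of the coefficients at `w` and at some other word in the multiplication of skew
power series. -/
def skewCoeffMul (w : Word) : A →ₗ[ℂ] A →ₗ[ℂ] A :=
  (LinearMap.mul ℂ A).compl₁₂ LinearMap.id (α ^ w.exp : A ≃ₐ[ℂ] A).toLinearMap

theorem skewCoeffMul_apply (w : Word) (a b : A) :
    skewCoeffMul α w a b = a * (α ^ w.exp : A ≃ₐ[ℂ] A) b :=
  rfl

/-- The universal property of projective seminorms, applied in each variable, reduces the claim to
`a = i_w(x)` and `b = i_v(y)`. There the product is `i_{wv}(x, y)`, and the numerical products
multiply. For nonempty words `r` may be any seminorm. -/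
theorem wordSeminorm_skewCoeffMul_le {m n : ℕ} (r : Seminorm ℂ A) (w : Fin (m + 1) → Fin 2)
    (v : Fin (n + 1) → Fin 2) (a b : A) :
    wordSeminorm α r (Word.append ⟨m + 1, w⟩ ⟨n + 1, v⟩) (skewCoeffMul α ⟨m + 1, w⟩ a b) ≤
      wordSeminorm α r ⟨m + 1, w⟩ a * wordSeminorm α r ⟨n + 1, v⟩ b := by
  rw [mul_comm]
  refine le_wordSeminorm α (t := (wordSeminorm α r (Word.append ⟨m + 1, w⟩ ⟨n + 1, v⟩)).comp
    ((skewCoeffMul α ⟨m + 1, w⟩).flip b)) (apply_nonneg _ _) (fun x => ?_) a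
  rw [mul_comm]
  refine le_wordSeminorm α (t := (wordSeminorm α r (Word.append ⟨m + 1, w⟩ ⟨n + 1, v⟩)).comp
    (skewCoeffMul α ⟨m + 1, w⟩ (wordMap α w x)))
    (Finset.prod_nonneg fun i _ => apply_nonneg _ _) (fun y => ?_) b
  rw [Seminorm.comp_apply, skewCoeffMul_apply]
  -- The length `m + 1 + (n + 1)` is definitionally the successor of `m + 1 + n`, so the
  -- concatenation is again of the form required for nonempty words.
  have h := wordSeminorm_wordMap_le α r (n := m + 1 + n)
    (Fin.append w v : Fin (m + 1 + (n + 1)) → Fin 2) (Fin.append x y : Fin (m + 1 + (n + 1)) → A)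
  have h1 := wordMap_append α w v x y
  have h2 : ∏ i : Fin (m + 1 + n + 1), r ((Fin.append x y : Fin (m + 1 + (n + 1)) → A) i) =
      (∏ i, r (x i)) * ∏ i, r (y i) := by
    refine (Fin.prod_univ_add (a := m + 1) (b := n + 1) fun i => r (Fin.append x y i)).trans ?_
    simp only [Fin.append_left, Fin.append_right]
  rw [h2] at h
  refine le_trans (le_of_eq ?_) h
  exact congrArg _ h1.symm

/-- With an empty left word, `a` is absorbed into the first entry. With an empty right word, `b`
reaches the last entry as `α^{±1}(b)`, the sign being given by the last letter. Hence only the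
translates under `α` and `α⁻¹` are needed in `twistSup`. -/
theorem twistedWordSeminorm_skewCoeffMul_le {r : Seminorm ℂ A}
    (hr : ∀ x y, r (x * y) ≤ r x * r y) (w v : Word) (a b : A) :
    twistedWordSeminorm α r (w.append v) (skewCoeffMul α w a b) ≤
      twistedWordSeminorm α r w a * twistedWordSeminorm α r v b := by
  obtain ⟨m, w⟩ := w
  obtain ⟨n, v⟩ := v
  cases m with
  | zero =>
    rw [Word.eq_nil w, Word.nil_append, skewCoeffMul_apply, Word.exp_nil, zpow_zero_apply]
    cases n with
    | zero => exact twistSup_mul_le α hr a b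
    | succ n =>
      refine le_wordSeminorm α (t := (wordSeminorm α r ⟨n + 1, v⟩).comp (LinearMap.mul ℂ A a))
        (apply_nonneg _ _) (fun x => ?_) b
      rw [Seminorm.comp_apply, LinearMap.mul_apply', ← wordMap_update_zero]
      refine (wordSeminorm_wordMap_le α r v _).trans ?_
      rw [Fin.prod_univ_succ, Fin.prod_univ_succ, Function.update_self, ← mul_assoc]
      refine mul_le_mul ((hr _ _).trans ?_) (le_of_eq ?_)
        (Finset.prod_nonneg fun i _ => apply_nonneg _ _)
        (mul_nonneg (apply_nonneg _ _) (apply_nonneg _ _))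
      · exact mul_le_mul_of_nonneg_right (le_twistSup α r a) (apply_nonneg _ _)
      · simp
  | succ m =>
    cases n with
    | zero =>
      rw [Word.eq_nil v, Word.append_nil, mul_comm]
      refine le_wordSeminorm α (t := (wordSeminorm α r ⟨m + 1, w⟩).comp
        ((skewCoeffMul α ⟨m + 1, w⟩).flip b)) (apply_nonneg _ _) (fun x => ?_) a
      rw [Seminorm.comp_apply, LinearMap.flip_apply, skewCoeffMul_apply]
      refine le_trans (le_of_eq (congrArg _ (wordMap_update_last α w b x).symm)) ?_
      refine (wordSeminorm_wordMap_le α r w _).trans ?_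
      rw [Fin.prod_univ_castSucc, Fin.prod_univ_castSucc, Function.update_self, mul_comm,
        mul_comm _ (r (x (Fin.last m))), ← mul_assoc]
      refine mul_le_mul ((hr _ _).trans ?_) (le_of_eq ?_)
        (Finset.prod_nonneg fun i _ => apply_nonneg _ _)
        (mul_nonneg (apply_nonneg _ _) (apply_nonneg _ _))
      · rw [mul_comm]
        exact mul_le_mul_of_nonneg_right (zpow_letterExp_le_twistSup α r _ b) (apply_nonneg _ _)
      · refine Finset.prod_congr rfl fun i _ => ?_
        rw [Function.update_of_ne (Fin.castSucc_lt_last i).ne]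
    | succ n => exact wordSeminorm_skewCoeffMul_le α r w v a b

end TwistedWordSeminorms

/-! ### The algebra of skew power series -/

namespace SkewSeries

section Algebra

variable {A : Type*} [Ring A] [Algebra ℂ A] [UniformSpace A]

theorem withSeminorms_twisted {α : A ≃ₐ[ℂ] A} (hA : IsArensMichael A fun a b => a * b)
    (hα : Continuous α) (hα' : Continuous α.symm) (w : Word) :
    WithSeminorms fun r : SubmultSeminorm A => twistedWordSeminorm α r.1 w := by
  have := hA.isUniformAddGroup
  have hr := withSeminorms_submult hA
  have := hr.continuousSMul
  refine withSeminorms_of_bounds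
    (withSeminorms_wordSeminorm hA hα hα' hr isDirectedFamily_submult w)
    (fun r => continuous_twistedWordSeminorm hα hα' r.2.1 w) fun r => ⟨r, 1, fun a => ?_⟩
  rw [one_mul]
  exact wordSeminorm_le_twisted α r.1 w a

variable (α : A ≃ₐ[ℂ] A)

/-- Skew power series with respect to all continuous submultiplicative seminorms. -/
abbrev Twisted : Type _ :=
  WeightedSum (E := fun _ : Word => A) (fun w => w.1)
    fun (r : SubmultSeminorm A) w => twistedWordSeminorm α r.1 w

/-- The graded multiplication of skew power series. -/
def gradedProduct : WeightedSum.GradedProduct (A := A) (fun w : Word => w.1)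
    fun (r : SubmultSeminorm A) w => twistedWordSeminorm α r.1 w where
  op := Word.append
  coeffMul w _ := skewCoeffMul α w
  degree_op _ _ := rfl
  le_mul r := twistedWordSeminorm_skewCoeffMul_le α r.2.2

/-- The algebra structure of the space of skew power series with respect to all continuous
submultiplicative seminorms. -/
def twistedStructure [CompleteSpace (Twisted α)] [T2Space (Twisted α)] :
    AlgStructure (Twisted α) :=
  (gradedProduct α).algStructure Word.nil 1
    (fun u a v b w c => by
      change WeightedSum.single _ _ ((u.append v).append w) _ =
        WeightedSum.single _ _ (u.append (v.append w)) _
      rw [Word.append_assoc]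
      simp [gradedProduct, skewCoeffMul_apply, Word.exp_append, zpow_add_apply, mul_assoc])
    (fun w a => by
      change WeightedSum.single _ _ (Word.nil.append w) _ = _
      rw [Word.nil_append]
      simp [gradedProduct, skewCoeffMul_apply, Word.exp_nil])
    (fun w a => by
      change WeightedSum.single _ _ (w.append Word.nil) _ = _
      rw [Word.append_nil]
      simp [gradedProduct, skewCoeffMul_apply])

variable {α}

theorem completeSpace_twisted (hA : IsArensMichael A fun a b => a * b) (hα : Continuous α)
    (hα' : Continuous α.symm) : CompleteSpace (Twisted α) :=
  have := hA.isUniformAddGroup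
  have := hA.completeSpace
  have : Nonempty (SubmultSeminorm A) := isDirectedFamily_submult.1
  WeightedSum.completeSpace (withSeminorms_twisted hA hα hα')

theorem t2Space_twisted (hA : IsArensMichael A fun a b => a * b) (hα : Continuous α)
    (hα' : Continuous α.symm) : T2Space (Twisted α) :=
  have := hA.t2Space
  have : Nonempty (SubmultSeminorm A) := isDirectedFamily_submult.1
  WeightedSum.t2Space (withSeminorms_twisted hA hα hα')

variable {Λ : Type*} {p : Λ → Seminorm ℂ A}

theorem dominates_twisted (hα : Continuous α) (hα' : Continuous α.symm) (hp : WithSeminorms p)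
    (hpd : IsDirectedFamily p) :
    WeightedSum.Dominates (E := fun _ : Word => A) (fun w => w.1)
      (fun l w => wordSeminorm α (p l) w)
      fun (r : SubmultSeminorm A) w => twistedWordSeminorm α r.1 w := by
  intro r
  obtain ⟨l, C, hC, h⟩ := exists_bound_of_directed hp hpd (continuous_twistSup hα hα' r.2.1)
  refine ⟨l, C, zero_le_one.trans hC, ⟨C, zero_lt_one.trans_le hC⟩, fun w a => ?_⟩
  exact (twisted_le_wordSeminorm α r.1 w a).trans (wordSeminorm_mono α hC h w a)

theorem twisted_dominates (hA : IsArensMichael A fun a b => a * b) (hp : WithSeminorms p) :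
    WeightedSum.Dominates (E := fun _ : Word => A) (fun w => w.1)
      (fun (r : SubmultSeminorm A) w => twistedWordSeminorm α r.1 w)
      fun l w => wordSeminorm α (p l) w := by
  intro l
  obtain ⟨r, C, hC, h⟩ := exists_bound_of_directed (withSeminorms_submult hA)
    isDirectedFamily_submult (hp.continuous_seminorm l)
  have hC0 : 0 ≤ C := zero_le_one.trans hC
  refine ⟨r, C, hC0, ⟨C, zero_lt_one.trans_le hC⟩, fun w a => ?_⟩
  refine (wordSeminorm_mono α hC h w a).trans ?_
  exact mul_le_mul_of_nonneg_left (wordSeminorm_le_twisted α r.1 w a) (by positivity)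

/-- The space of skew power series does not depend on the family of seminorms. -/
def twistedEquiv (hA : IsArensMichael A fun a b => a * b) (hα : Continuous α)
    (hα' : Continuous α.symm) (hp : WithSeminorms p) (hpd : IsDirectedFamily p) :
    Twisted α ≃L[ℂ] SkewSeries α p :=
  WeightedSum.changeEquiv (twisted_dominates hA hp) (dominates_twisted hα hα' hp hpd)

theorem twistedEquiv_single (hA : IsArensMichael A fun a b => a * b) (hα : Continuous α)
    (hα' : Continuous α.symm) (hp : WithSeminorms p) (hpd : IsDirectedFamily p) (w : Word)
    (a : A) : twistedEquiv hA hα hα' hp hpd (WeightedSum.single _ _ w a) = monomial α p w a :=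
  rfl

/-- The algebra of skew power series. -/
theorem exists_structure (hA : IsArensMichael A fun a b => a * b) (hα : Continuous α)
    (hα' : Continuous α.symm) (hp : WithSeminorms p) (hpd : IsDirectedFamily p) :
    ∃ μ : AlgStructure (SkewSeries α p), IsArensMichael (SkewSeries α p) (fun f g => μ.mul f g) ∧
      μ.one = monomial α p Word.nil 1 ∧ ∀ w v a b,
        μ.mul (monomial α p w a) (monomial α p v b) =
          monomial α p (w.append v) (a * (α ^ w.exp : A ≃ₐ[ℂ] A) b) := by
  have := completeSpace_twisted hA hα hα'
  have := t2Space_twisted hA hα hα'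
  have hT : IsArensMichael (Twisted α) fun f g => (twistedStructure α).mul f g :=
    (gradedProduct α).isArensMichael
  refine ⟨(twistedStructure α).transport (twistedEquiv hA hα hα' hp hpd).toLinearEquiv,
    hT.transport (twistedEquiv hA hα hα' hp hpd), rfl, fun w v a b => ?_⟩
  rw [← twistedEquiv_single hA hα hα' hp hpd, ← twistedEquiv_single hA hα hα' hp hpd,
    ← twistedEquiv_single hA hα hα' hp hpd]
  refine (AlgStructure.transport_mul (twistedEquiv hA hα hα' hp hpd).toLinearEquiv _ _ _).trans ?_
  exact congrArg _ ((gradedProduct α).mul_single_single w a v b)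

end Algebra

/-- Two continuous linear maps agree if they agree on the monomials. -/
theorem linearMap_ext {A : Type*} [Ring A] [Algebra ℂ A] {α : A ≃ₐ[ℂ] A} {Λ : Type*}
    {p : Λ → Seminorm ℂ A} {Y : Type*} [AddCommGroup Y] [Module ℂ Y] [TopologicalSpace Y]
    [T2Space Y] {f g : SkewSeries α p →ₗ[ℂ] Y} (hf : Continuous f) (hg : Continuous g)
    (h : ∀ w a, f (monomial α p w a) = g (monomial α p w a)) : f = g :=
  WeightedSum.linearMap_ext hf hg h

/-! ### The two Ore extensions inside the algebra of series. -/

section Ore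

variable {A : Type*} [Ring A] [Algebra ℂ A] {α : A ≃ₐ[ℂ] A} {Λ : Type*} {p : Λ → Seminorm ℂ A}

theorem oreIncl_monomial (β : A ≃ₐ[ℂ] A) (i : Fin 2) (n : ℕ) (a : A) :
    oreIncl α p β i (SkewPolynomial.monomial n (a : OreCoeff β)) =
      monomial α p ⟨n, fun _ => i⟩ a :=
  SkewPolynomial.sum_monomial_index (R := OreCoeff β) (n := n) (b := a)
    (h := fun n (a : A) => monomial α p ⟨n, fun _ => i⟩ a) (map_zero (monomial α p ⟨n, fun _ => i⟩))

/-- The word `x_i^m` has total exponent `m * letterExp i`, so it acts on coefficients by `β ^ m`.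
This is the rule `t^m b = β^m(b) t^m`. -/
theorem isOreHom_oreIncl {μ : AlgStructure (SkewSeries α p)}
    (h1 : μ.one = monomial α p Word.nil 1)
    (hm : ∀ w v a b, μ.mul (monomial α p w a) (monomial α p v b) =
      monomial α p (w.append v) (a * (α ^ w.exp : A ≃ₐ[ℂ] A) b))
    (β : A ≃ₐ[ℂ] A) (i : Fin 2) (hβ : β = α ^ letterExp i) : IsOreHom μ (oreIncl α p β i) := by
  have hexp : ∀ m : ℕ, (α ^ (Word.exp ⟨m, fun _ => i⟩) : A ≃ₐ[ℂ] A) = β ^ m := by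
    intro m
    rw [hβ, ← zpow_natCast, ← zpow_mul]
    congr 1
    simp [Word.exp, wordExp, mul_comm]
  have happ : ∀ m n : ℕ, Word.append ⟨m, fun _ => i⟩ ⟨n, fun _ => i⟩ = ⟨m + n, fun _ => i⟩ := by
    intro m n
    refine congrArg (Sigma.mk (m + n)) ?_
    funext k
    induction k using Fin.addCases <;> simp
  have hmon : ∀ (m n : ℕ) (a b : A), μ.mul (monomial α p ⟨m, fun _ => i⟩ a)
      (monomial α p ⟨n, fun _ => i⟩ b) =
        monomial α p ⟨m + n, fun _ => i⟩ (a * (β ^ m : A ≃ₐ[ℂ] A) b) := by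
    intro m n a b
    rw [hm, hexp, happ]
  refine ⟨?_, fun f g => ?_⟩
  · rw [h1]
    refine (oreIncl_monomial β i 0 1).trans ?_
    rw [Word.eq_nil]
  · induction f using SkewPolynomial.induction with
    | h0 => simp
    | ha m a f _ _ hf =>
      rw [add_mul, map_add, map_add, hf, map_add, LinearMap.add_apply]
      congr 1
      clear hf
      induction g using SkewPolynomial.induction with
      | h0 => simp
      | ha n b g _ _ hg =>
        rw [mul_add, map_add, map_add, hg, map_add]
        congr 1
        refine Eq.trans ?_ (congrArg₂ (fun x y => μ.mul x y)
          (oreIncl_monomial (p := p) β i m a) (oreIncl_monomial (p := p) β i n b)).symm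
        refine Eq.trans ?_ (hmon m n a b).symm
        have h := SkewPolynomial.monomial_mul_monomial m n a b
        rw [SkewPolynomial.φ_iterate_apply] at h
        exact (congrArg _ h).trans (oreIncl_monomial β i (m + n) _)

end Ore

end SkewSeries

/-! ### Tensor powers of the twisted bimodule -/

section Letters

variable {A : Type*} [Ring A] [Algebra ℂ A] (α : A ≃ₐ[ℂ] A)

/-- The inclusion of one of the two summands of `A_α ⊕ A_{α⁻¹}` as a linear map. -/
def letterInclLinear (i : Fin 2) : A →ₗ[ℂ] Twist α × Twist α⁻¹ where
  toFun := letterIncl α i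
  map_add' a b := by
    unfold letterIncl
    split_ifs
    · exact Prod.ext rfl (add_zero _).symm
    · exact Prod.ext (add_zero _).symm rfl
  map_smul' c a := by
    unfold letterIncl
    split_ifs
    · exact Prod.ext rfl (smul_zero _).symm
    · exact Prod.ext (smul_zero _).symm rfl

/-- The projection to one of the two summands of `A_α ⊕ A_{α⁻¹}`. -/
def letterProj (i : Fin 2) : Twist α × Twist α⁻¹ →ₗ[ℂ] A where
  toFun m := if i = 0 then Twist.val α m.1 else Twist.val α⁻¹ m.2
  map_add' m m' := by split_ifs <;> rfl
  map_smul' c m := by split_ifs <;> rfl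

theorem letterProj_letterIncl (i j : Fin 2) (a : A) :
    letterProj α j (letterIncl α i a) = if j = i then a else 0 := by
  fin_cases i <;> fin_cases j <;> rfl

theorem sum_letterIncl_letterProj (m : Twist α × Twist α⁻¹) :
    ∑ i, letterIncl α i (letterProj α i m) = m := by
  rw [Fin.sum_univ_two]
  exact Prod.ext (add_zero _) (zero_add _)

theorem zpow_letterExp_zero (a : A) : (α ^ letterExp 0 : A ≃ₐ[ℂ] A) a = α a := by
  simp [letterExp]

theorem zpow_letterExp_one (a : A) : (α ^ letterExp 1 : A ≃ₐ[ℂ] A) a = α⁻¹ a := by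
  simp [letterExp]

theorem letterProj_update {n : ℕ} (w : Fin n → Fin 2) (x : Fin n → Twist α × Twist α⁻¹)
    (l : Fin n) (m : Twist α × Twist α⁻¹) :
    (fun k => letterProj α (w k) (Function.update x l m k)) =
      Function.update (fun k => letterProj α (w k) (x k)) l (letterProj α (w l) m) :=
  funext fun k => Function.apply_update (fun k => letterProj α (w k)) x l m k

theorem letterProj_smul (i : Fin 2) (a : A) (m : Twist α × Twist α⁻¹) :
    letterProj α i (a • m) = a * letterProj α i m := by
  fin_cases i <;> rfl

theorem letterProj_op_smul (i : Fin 2) (a : A) (m : Twist α × Twist α⁻¹) :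
    letterProj α i (MulOpposite.op a • m) =
      letterProj α i m * (α ^ letterExp i : A ≃ₐ[ℂ] A) a := by
  fin_cases i
  · exact congrArg _ (zpow_letterExp_zero α a).symm
  · exact congrArg _ (zpow_letterExp_one α a).symm

theorem smul_letterIncl (i : Fin 2) (a b : A) : a • letterIncl α i b = letterIncl α i (a * b) := by
  fin_cases i
  · exact Prod.ext rfl (smul_zero _)
  · exact Prod.ext (smul_zero _) rfl

theorem op_smul_letterIncl (i : Fin 2) (a b : A) :
    MulOpposite.op a • letterIncl α i b =
      letterIncl α i (b * (α ^ letterExp i : A ≃ₐ[ℂ] A) a) := by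
  fin_cases i
  · exact Prod.ext (congrArg (fun c : A => b * c) (zpow_letterExp_zero α a).symm)
      (smul_zero (M := Aᵐᵒᵖ) (A := Twist α⁻¹) _)
  · exact Prod.ext (smul_zero (M := Aᵐᵒᵖ) (A := Twist α) _)
      (congrArg (fun c : A => b * c) (zpow_letterExp_one α a).symm)

theorem continuous_letterIncl [UniformSpace A] (i : Fin 2) : Continuous (letterIncl α i) := by
  fin_cases i
  · exact Continuous.prodMk (Y := Twist α) (Z := Twist α⁻¹)
      (continuous_id : Continuous (id : A → A)) continuous_const
  · exact Continuous.prodMk (Y := Twist α) (Z := Twist α⁻¹) continuous_const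
      (continuous_id : Continuous (id : A → A))

theorem continuous_letterProj [UniformSpace A] (i : Fin 2) : Continuous (letterProj α i) := by
  fin_cases i
  · exact (continuous_fst : Continuous (Prod.fst : Twist α × Twist α⁻¹ → _))
  · exact (continuous_snd : Continuous (Prod.snd : Twist α × Twist α⁻¹ → _))

/-- Passing from place `i` to the next place adds the exponent of the letter `w i`, exactly the
twist in the right action on entry `i`. So `i_w` respects the relations of the tensor product over
`A`. -/
theorem wordMap_update_balanced {n : ℕ} (w : Fin n → Fin 2) (x : Fin n → A) (a : A) (i j : Fin n)
    (hij : (i : ℕ) + 1 = j) :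
    wordMap α w (Function.update x i (x i * (α ^ letterExp (w i) : A ≃ₐ[ℂ] A) a)) =
      wordMap α w (Function.update x j (a * x j)) := by
  induction n with
  | zero => exact i.elim0
  | succ n ih =>
    have hsucc : ∀ (k : Fin n) (c : A), (fun l : Fin n => Function.update x k.succ c l.succ) =
        Function.update (fun l => x l.succ) k c := by
      intro k c
      funext l
      by_cases h : l = k
      · subst h
        rw [Function.update_self, Function.update_self]
      · rw [Function.update_of_ne h, Function.update_of_ne fun h' => h (Fin.succ_injective _ h')]
    obtain ⟨j, rfl⟩ := Fin.exists_succ_eq.2 (show j ≠ 0 from fun h => by simp [h] at hij)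
    rw [wordMap_succ α w (Function.update x j.succ _), hsucc,
      Function.update_of_ne (Fin.succ_ne_zero j).symm]
    -- The relation either joins the first two places or lies entirely in the tail, where induction
    -- applies.
    rcases Fin.eq_zero_or_eq_succ i with rfl | ⟨i, rfl⟩
    · obtain ⟨n, rfl⟩ : ∃ m, n = m + 1 := ⟨n - 1, by have := j.2; omega⟩
      have hj : j = 0 := by
        ext
        simpa using hij.symm
      subst hj
      rw [wordMap_succ, Function.update_self, wordMap_update_zero α _ a fun l => x l.succ, map_mul,
        mul_assoc]
      rfl
    · rw [wordMap_succ, Function.update_of_ne (Fin.succ_ne_zero i).symm, hsucc]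
      congr 2
      refine ih (fun l => w l.succ) (fun l => x l.succ) i j ?_
      simpa using hij

/-- All entries of a balanced function can be moved to the first place. -/
theorem balanced_eq_cons_wordMap {X : Type*} {n : ℕ} (w : Fin (n + 1) → Fin 2)
    (f : (Fin (n + 1) → A) → X)
    (hf : ∀ x a i j, ((i : Fin (n + 1)) : ℕ) + 1 = (j : Fin (n + 1)) →
      f (Function.update x i (x i * (α ^ letterExp (w i) : A ≃ₐ[ℂ] A) a)) =
        f (Function.update x j (a * x j)))
    (x : Fin (n + 1) → A) : f x = f (Fin.cons (wordMap α w x) fun _ => 1) := by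
  induction n with
  | zero =>
    congr 1
    funext i
    rw [show i = 0 from Fin.ext (by omega), Fin.cons_zero, wordMap_succ]
    simp [wordMap_apply]
  | succ n ih =>
    have h1 := ih (fun i => w i.succ) (fun s => f (Fin.cons (x 0) s)) (fun s a i j hij => by
      have := hf (Fin.cons (x 0) s) a i.succ j.succ (by simpa using hij)
      rwa [Fin.cons_succ, Fin.cons_succ, ← Fin.cons_update, ← Fin.cons_update] at this)
      (Fin.tail x)
    rw [Fin.cons_self_tail] at h1
    rw [h1]
    set b := wordMap α (fun i => w i.succ) (Fin.tail x) with hb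
    -- Induction has collected the tail into `b` at place `1`. Reading the balance relation
    -- backwards moves `b` into place `0`, twisted by the first letter.
    have h2 := hf (Fin.cons (x 0) fun _ => 1) b 0 1 (by simp)
    have h3 : Function.update (Fin.cons (x 0) fun _ => 1 : Fin (n + 2) → A) 1 (b * 1) =
        Fin.cons (x 0) (Fin.cons b fun _ => 1) := by
      rw [mul_one, ← Fin.succ_zero_eq_one, ← Fin.cons_update]
      congr 1
      funext l
      refine Fin.cases ?_ (fun l => ?_) l <;> simp
    rw [show (Fin.cons (x 0) fun _ => 1 : Fin (n + 2) → A) 1 = 1 from rfl, h3] at h2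
    rw [← h2, Fin.update_cons_zero, Fin.cons_zero, wordMap_succ]
    rfl

end Letters

/-! ### Coordinates of tensor powers indexed by words. -/

section TensorPowers

variable {A : Type*} [Ring A] [Algebra ℂ A] {α : A ≃ₐ[ℂ] A} {κ : Type*}
  (q : κ → Seminorm ℂ (Twist α × Twist α⁻¹)) (n : ℕ)

theorem TensorPow.tmul_update_balanced (x : Fin (n + 1) → Twist α × Twist α⁻¹) (a : A)
    (i j : Fin (n + 1)) (hij : (i : ℕ) + 1 = j) :
    TensorPow.tmul A q n (Function.update x i (MulOpposite.op a • x i)) =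
      TensorPow.tmul A q n (Function.update x j (a • x j)) :=
  (Submodule.Quotient.eq _).2 (Submodule.subset_span ⟨x, a, i, j, hij, rfl⟩)

/-- The coordinates of an element of the tensor power of `A_α ⊕ A_{α⁻¹}`. -/
def toWords : TensorPow A q n →ₗ[ℂ] (Fin (n + 1) → Fin 2) → A :=
  (balancedRelations A (Twist α × Twist α⁻¹) (n + 1)).liftQ
    (PiTensorProduct.lift (MultilinearMap.pi fun w =>
      (wordMap α w).compLinearMap fun k => letterProj α (w k))) <| by
    rw [balancedRelations, Submodule.span_le]
    rintro _ ⟨x, a, i, j, hij, rfl⟩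
    rw [SetLike.mem_coe, LinearMap.mem_ker, map_sub, sub_eq_zero, PiTensorProduct.lift.tprod,
      PiTensorProduct.lift.tprod]
    funext w
    simp only [MultilinearMap.pi_apply, MultilinearMap.compLinearMap_apply,
      letterProj_update, letterProj_smul, letterProj_op_smul]
    exact wordMap_update_balanced α w (fun k => letterProj α (w k) (x k)) a i j hij

theorem toWords_tmul (x : Fin (n + 1) → Twist α × Twist α⁻¹) (w : Fin (n + 1) → Fin 2) :
    toWords q n (TensorPow.tmul A q n x) w = wordMap α w fun k => letterProj α (w k) (x k) := by
  refine (congrFun (Submodule.liftQ_apply _ _ _) w).trans ?_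
  rw [PiTensorProduct.lift.tprod]
  rfl

/-- The elementary tensor `a ⊗ 1 ⊗ ⋯ ⊗ 1`, with factors in the summands of `A_α ⊕ A_{α⁻¹}`
prescribed by a word. -/
def wordTensor (w : Fin (n + 1) → Fin 2) : A →ₗ[ℂ] TensorPow A q n where
  toFun a := TensorPow.tmul A q n fun k =>
    letterIncl α (w k) ((Fin.cons a fun _ => 1 : Fin (n + 1) → A) k)
  map_add' a b := ((TensorPow.tmul A q n).compLinearMap fun k =>
    letterInclLinear α (w k)).cons_add (fun _ => 1) a b
  map_smul' c a := ((TensorPow.tmul A q n).compLinearMap fun k =>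
    letterInclLinear α (w k)).cons_smul (fun _ => 1) c a

theorem wordTensor_apply (w : Fin (n + 1) → Fin 2) (a : A) :
    wordTensor q n w a = TensorPow.tmul A q n fun k =>
      letterIncl α (w k) ((Fin.cons a fun _ => 1 : Fin (n + 1) → A) k) :=
  rfl

theorem tmul_letterIncl (w : Fin (n + 1) → Fin 2) (x : Fin (n + 1) → A) :
    (TensorPow.tmul A q n fun k => letterIncl α (w k) (x k)) =
      wordTensor q n w (wordMap α w x) := by
  refine balanced_eq_cons_wordMap α w
    (fun x => TensorPow.tmul A q n fun k => letterIncl α (w k) (x k)) (fun x a i j hij => ?_) x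
  have h : ∀ (l : Fin (n + 1)) (c : A), (fun k => letterIncl α (w k) (Function.update x l c k)) =
      Function.update (fun k => letterIncl α (w k) (x k)) l (letterIncl α (w l) c) :=
    fun l c => funext fun k => Function.apply_update (fun k => letterIncl α (w k)) x l c k
  have := TensorPow.tmul_update_balanced q n (fun k => letterIncl α (w k) (x k)) a i j hij
  rw [op_smul_letterIncl, smul_letterIncl] at this
  simp only [h]
  exact this

/-- Splitting every factor into its two components and expanding multilinearly gives one term for
each word. -/
theorem tmul_eq_sum (x : Fin (n + 1) → Twist α × Twist α⁻¹) :
    TensorPow.tmul A q n x = ∑ w : Fin (n + 1) → Fin 2,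
      wordTensor q n w (wordMap α w fun k => letterProj α (w k) (x k)) := by
  have h := (TensorPow.tmul A q n).map_sum fun k (i : Fin 2) =>
    letterIncl α i (letterProj α i (x k))
  simp only [sum_letterIncl_letterProj] at h
  rw [h]
  exact Finset.sum_congr rfl fun w _ => tmul_letterIncl q n w fun k => letterProj α (w k) (x k)

theorem toWords_wordTensor (w : Fin (n + 1) → Fin 2) (a : A) :
    toWords q n (wordTensor q n w a) = Pi.single w a := by
  funext v
  rw [wordTensor_apply, toWords_tmul]
  simp only [letterProj_letterIncl]
  by_cases h : v = w
  · subst h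
    simp only [if_true, wordMap_cons_one, Pi.single_eq_same]
  · rw [Pi.single_eq_of_ne h]
    obtain ⟨k, hk⟩ := Function.ne_iff.1 h
    exact (wordMap α v).map_coord_zero k (if_neg hk)

/-- The tensor power of `A_α ⊕ A_{α⁻¹}` is a direct sum of copies of `A` indexed by words. -/
def tensorPowEquiv : TensorPow A q n ≃ₗ[ℂ] ((Fin (n + 1) → Fin 2) → A) :=
  LinearEquiv.ofLinearMap (toWords q n)
    (∑ w : Fin (n + 1) → Fin 2, (wordTensor q n w).comp (LinearMap.proj w))
    (by
      ext a v
      simp only [LinearMap.coe_comp, Function.comp_apply, LinearMap.sum_apply, map_sum,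
        Finset.sum_apply, toWords_wordTensor, LinearMap.proj_apply]
      simp [Pi.single_apply])
    (by
      refine LinearMap.ext_on (TensorPow.span_tmul A q n) ?_
      rintro _ ⟨x, rfl⟩
      simp only [LinearMap.coe_comp, Function.comp_apply, LinearMap.sum_apply, toWords_tmul,
        LinearMap.proj_apply, LinearMap.id_apply]
      exact (tmul_eq_sum q n x).symm)

theorem tensorPowEquiv_symm_apply (a : (Fin (n + 1) → Fin 2) → A) :
    (tensorPowEquiv q n).symm a = ∑ w, wordTensor q n w (a w) := by
  change (∑ w : Fin (n + 1) → Fin 2, (wordTensor q n w).comp (LinearMap.proj w)) a = _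
  simp

end TensorPowers

/-! ### Grouping the coefficients of series by degree -/

section Regroup

theorem summable_sum_words {g : Word → ℝ} (hg : Summable g) :
    Summable fun n : ℕ => ∑ w : Fin (n + 1) → Fin 2, g ⟨n + 1, w⟩ := by
  have h := hg.sigma
  simp only [tsum_fintype] at h
  exact (summable_nat_add_iff
    (f := fun n : ℕ => ∑ w : Fin n → Fin 2, g ⟨n, w⟩) 1).2 h

theorem tsum_eq_add_tsum_words {g : Word → ℝ} (hg : Summable g) :
    ∑' w, g w = g Word.nil + ∑' n : ℕ, ∑ w : Fin (n + 1) → Fin 2, g ⟨n + 1, w⟩ := by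
  have h := hg.sigma
  simp only [tsum_fintype] at h
  rw [hg.tsum_sigma]
  simp only [tsum_fintype]
  rw [h.tsum_eq_zero_add]
  congr 1
  rw [Fintype.sum_eq_single (Fin.elim0 : Fin 0 → Fin 2) fun w hw =>
    (hw (Subsingleton.elim _ _)).elim]
  rfl

theorem summable_of_sum_words {g : Word → ℝ} (hg : ∀ w, 0 ≤ g w)
    (h : Summable fun n : ℕ => ∑ w : Fin (n + 1) → Fin 2, g ⟨n + 1, w⟩) : Summable g := by
  refine (summable_sigma_of_nonneg hg).2 ⟨fun n => Summable.of_finite, ?_⟩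
  simp only [tsum_fintype]
  exact (summable_nat_add_iff
    (f := fun n : ℕ => ∑ w : Fin n → Fin 2, g ⟨n, w⟩) 1).1 h

variable {A Λ κ : Type*} {F : ℕ → Type*} [AddCommGroup A] [Module ℂ A]
  [∀ n, AddCommGroup (F n)] [∀ n, Module ℂ (F n)] {N : Λ → Word → Seminorm ℂ A}
  {N' : κ → ∀ n, Seminorm ℂ (F n)} (e : ∀ n, F n ≃ₗ[ℂ] ((Fin (n + 1) → Fin 2) → A))

/-- The projective seminorms are bounded by the sums of the seminorms of the coordinates. -/
def BoundedByWords (N : Λ → Word → Seminorm ℂ A) (N' : κ → ∀ n, Seminorm ℂ (F n))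
    (e : ∀ n, F n ≃ₗ[ℂ] ((Fin (n + 1) → Fin 2) → A)) : Prop :=
  ∀ k, ∃ l, ∃ C : ℝ, 0 < C ∧ ∀ n a,
    N' k n ((e n).symm a) ≤ C ^ (n + 1) * ∑ w, N l ⟨n + 1, w⟩ (a w)

/-- The sums of the seminorms of the coordinates are bounded by the projective seminorms. -/
def BoundsWords (N : Λ → Word → Seminorm ℂ A) (N' : κ → ∀ n, Seminorm ℂ (F n))
    (e : ∀ n, F n ≃ₗ[ℂ] ((Fin (n + 1) → Fin 2) → A)) : Prop :=
  ∀ l, ∃ k, ∃ C : ℝ, 0 < C ∧ ∀ n y,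
    ∑ w, N l ⟨n + 1, w⟩ (e n y w) ≤ C ^ (n + 1) * N' k n y

/-- The factor `C ^ (n + 1)` is absorbed into the radius `C * ρ`. -/
theorem BoundedByWords.exists_bound (h : BoundedByWords N N' e) (k : κ) (ρ : Set.Ioi (0 : ℝ)) :
    ∃ (l : Λ) (σ : Set.Ioi (0 : ℝ)), ∀ n a, N' k n ((e n).symm a) * (ρ : ℝ) ^ (n + 1) ≤
      ∑ w, N l ⟨n + 1, w⟩ (a w) * (σ : ℝ) ^ (n + 1) := by
  obtain ⟨l, C, hC, h⟩ := h k
  have hρ : (0 : ℝ) < ρ := ρ.2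
  refine ⟨l, ⟨C * ρ, mul_pos hC hρ⟩, fun n a => ?_⟩
  refine (mul_le_mul_of_nonneg_right (h n a) (by positivity)).trans_eq ?_
  rw [← Finset.sum_mul, mul_pow]
  ring

theorem BoundsWords.exists_bound (h : BoundsWords N N' e) (l : Λ) (ρ : Set.Ioi (0 : ℝ)) :
    ∃ (k : κ) (σ : Set.Ioi (0 : ℝ)), ∀ n y, ∑ w, N l ⟨n + 1, w⟩ (e n y w) * (ρ : ℝ) ^ (n + 1) ≤
      N' k n y * (σ : ℝ) ^ (n + 1) := by
  obtain ⟨k, C, hC, h⟩ := h l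
  have hρ : (0 : ℝ) < ρ := ρ.2
  refine ⟨k, ⟨C * ρ, mul_pos hC hρ⟩, fun n y => ?_⟩
  rw [← Finset.sum_mul]
  refine (mul_le_mul_of_nonneg_right (h n y) (by positivity)).trans_eq ?_
  rw [mul_pow]
  ring

variable {e} (h : BoundedByWords N N' e) (h' : BoundsWords N N' e)

theorem summable_sum_words_coeff
    (x : WeightedSum (E := fun _ : Word => A) (fun w => w.1) N) (l : Λ) (σ : Set.Ioi (0 : ℝ)) :
    Summable fun n : ℕ => ∑ w : Fin (n + 1) → Fin 2,
      N l ⟨n + 1, w⟩ (WeightedSum.coeff _ N x ⟨n + 1, w⟩) * (σ : ℝ) ^ (n + 1) :=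
  summable_sum_words (g := fun w => N l w (WeightedSum.coeff _ N x w) * (σ : ℝ) ^ w.1)
    (WeightedSum.summable _ N x l σ.2)

/-- The part of positive degree of a series, grouped by degree. -/
def groupWords : WeightedSum (E := fun _ : Word => A) (fun w => w.1) N →ₗ[ℂ]
    WeightedSum (fun n : ℕ => n + 1) N' where
  toFun x := WeightedSum.mk (fun n => (e n).symm fun w => WeightedSum.coeff _ N x ⟨n + 1, w⟩)
    fun k ρ hρ => by
      obtain ⟨l, σ, hb⟩ := h.exists_bound e k ⟨ρ, hρ⟩
      exact Summable.of_nonneg_of_le (fun n => mul_nonneg (apply_nonneg _ _) (by positivity))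
        (fun n => hb n _) (summable_sum_words_coeff x l σ)
  map_add' x y := WeightedSum.ext fun n => (e n).symm.map_add _ _
  map_smul' c x := WeightedSum.ext fun n => (e n).symm.map_smul c _

theorem coeff_groupWords (x : WeightedSum (E := fun _ : Word => A) (fun w => w.1) N) (n : ℕ) :
    WeightedSum.coeff _ N' (groupWords h x) n =
      (e n).symm fun w => WeightedSum.coeff _ N x ⟨n + 1, w⟩ :=
  rfl

theorem continuous_groupWords : Continuous (groupWords h) := by
  refine continuous_of_seminorm_bound (WeightedSum.withSeminorms _ N') _ fun ⟨k, ρ⟩ => ?_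
  obtain ⟨l, σ, hb⟩ := h.exists_bound e k ρ
  refine ⟨WeightedSum.norm _ N l σ, WeightedSum.continuous_norm _ N l σ, 1, fun x => ?_⟩
  rw [one_mul, WeightedSum.norm_apply, WeightedSum.norm_apply,
    tsum_eq_add_tsum_words (WeightedSum.summable _ N x l σ.2)]
  refine ((WeightedSum.summable _ N' (groupWords h x) k ρ.2).tsum_le_tsum (fun n => hb n _)
    (summable_sum_words_coeff x l σ)).trans ?_
  exact le_add_of_nonneg_left (WeightedSum.term_nonneg l σ _ _)

/-- The coefficient of a word of positive length. -/
def ungroupCoeff (e : ∀ n, F n ≃ₗ[ℂ] ((Fin (n + 1) → Fin 2) → A)) (y : ∀ n, F n) : Word → A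
  -- The constant term is added separately in `groupEquiv`, hence the value zero here.
  | ⟨0, _⟩ => 0
  | ⟨n + 1, w⟩ => e n (y n) w

theorem ungroupCoeff_add (y z : ∀ n, F n) (w : Word) :
    ungroupCoeff e (y + z) w = ungroupCoeff e y w + ungroupCoeff e z w := by
  obtain ⟨n, w⟩ := w
  cases n with
  | zero => exact (add_zero 0).symm
  | succ n => exact congrFun ((e n).map_add _ _) w

theorem ungroupCoeff_smul (c : ℂ) (y : ∀ n, F n) (w : Word) :
    ungroupCoeff e (c • y) w = c • ungroupCoeff e y w := by
  obtain ⟨n, w⟩ := w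
  cases n with
  | zero => exact (smul_zero c).symm
  | succ n => exact congrFun ((e n).map_smul _ _) w

/-- The series with given components in the positive degrees. -/
def ungroupWords : WeightedSum (fun n : ℕ => n + 1) N' →ₗ[ℂ]
    WeightedSum (E := fun _ : Word => A) (fun w => w.1) N where
  toFun y := WeightedSum.mk (ungroupCoeff e (WeightedSum.coeff _ N' y)) fun l ρ hρ => by
    obtain ⟨k, σ, hb⟩ := h'.exists_bound e l ⟨ρ, hρ⟩
    refine summable_of_sum_words (fun w => mul_nonneg (apply_nonneg _ _) (by positivity)) ?_
    exact Summable.of_nonneg_of_le (fun n => Finset.sum_nonneg fun w _ =>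
      mul_nonneg (apply_nonneg _ _) (by positivity))
      (fun n => hb n _) (WeightedSum.summable _ N' y k σ.2)
  map_add' y z := WeightedSum.ext fun w => ungroupCoeff_add _ _ w
  map_smul' c y := WeightedSum.ext fun w => ungroupCoeff_smul c _ w

theorem coeff_ungroupWords (y : WeightedSum (fun n : ℕ => n + 1) N') (w : Word) :
    WeightedSum.coeff _ N (ungroupWords h' y) w = ungroupCoeff e (WeightedSum.coeff _ N' y) w :=
  rfl

theorem continuous_ungroupWords : Continuous (ungroupWords h') := by
  refine continuous_of_seminorm_bound (WeightedSum.withSeminorms _ N) _ fun ⟨l, ρ⟩ => ?_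
  obtain ⟨k, σ, hb⟩ := h'.exists_bound e l ρ
  refine ⟨WeightedSum.norm _ N' k σ, WeightedSum.continuous_norm _ N' k σ, 1, fun y => ?_⟩
  have hs := WeightedSum.summable _ N (ungroupWords h' y) l ρ.2
  rw [one_mul, WeightedSum.norm_apply, WeightedSum.norm_apply, tsum_eq_add_tsum_words hs]
  have h0 : WeightedSum.coeff _ N (ungroupWords h' y) Word.nil = 0 := rfl
  rw [h0, map_zero, zero_mul, zero_add]
  exact (summable_sum_words hs).tsum_le_tsum (fun n => hb n _)
    (WeightedSum.summable _ N' y k σ.2)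

/-- Series over words are the same as pairs of a constant term and a series over the positive
degrees. -/
def groupEquiv [TopologicalSpace A] [Nonempty Λ] (hN : ∀ w, WithSeminorms fun l => N l w) :
    WeightedSum (E := fun _ : Word => A) (fun w => w.1) N ≃L[ℂ]
      A × WeightedSum (fun n : ℕ => n + 1) N' where
  toLinearMap := ((LinearMap.proj (R := ℂ) (φ := fun _ : Word => A) Word.nil).comp
    (WeightedSum.coeff _ N)).prod (groupWords h)
  invFun z := WeightedSum.single (E := fun _ : Word => A) _ N Word.nil z.1 + ungroupWords h' z.2
  left_inv x := by
    refine WeightedSum.ext fun w => ?_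
    rw [map_add, Pi.add_apply, WeightedSum.coeff_single, coeff_ungroupWords]
    obtain ⟨n, w⟩ := w
    cases n with
    | zero =>
      rw [Word.eq_nil, Pi.single_eq_same]
      exact add_zero _
    | succ n =>
      rw [Pi.single_eq_of_ne (by simp [Word.nil]), zero_add]
      exact congrFun ((e n).apply_symm_apply _) w
  right_inv z := by
    refine Prod.ext ?_ (WeightedSum.ext fun n => ?_)
    · change WeightedSum.coeff _ N (_ + ungroupWords h' z.2) Word.nil = z.1
      rw [map_add, Pi.add_apply, WeightedSum.coeff_single, coeff_ungroupWords, Pi.single_eq_same]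
      exact add_zero _
    · change WeightedSum.coeff _ N' (groupWords h _) n = _
      rw [coeff_groupWords, LinearEquiv.symm_apply_eq]
      funext w
      rw [map_add, Pi.add_apply, WeightedSum.coeff_single, coeff_ungroupWords,
        Pi.single_eq_of_ne (by simp [Word.nil]), zero_add]
      rfl
  continuous_toFun := (WeightedSum.continuous_coeff hN Word.nil).prodMk (continuous_groupWords h)
  continuous_invFun := by
    have := (hN Word.nil).topologicalAddGroup
    have := (hN Word.nil).continuousSMul
    have hs : Continuous
        (WeightedSum.single (E := fun _ : Word => A) (fun w => w.1) N Word.nil) := by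
      refine continuous_of_seminorm_bound (WeightedSum.withSeminorms _ N) _ fun ⟨l, ρ⟩ => ?_
      refine ⟨N l Word.nil, (hN Word.nil).continuous_seminorm l, 1, fun a => ?_⟩
      rw [WeightedSum.norm_single]
      simp [Word.nil]
    exact (hs.comp continuous_fst).add ((continuous_ungroupWords h').comp continuous_snd)

end Regroup

/-! ### The completed tensor powers of the twisted bimodule -/

section Completion

variable (A : Type*) {M κ : Type*} [Ring A] [AddCommGroup M] [Module ℂ M] [Module A M]
  [Module Aᵐᵒᵖ M] (q : κ → Seminorm ℂ M) (n : ℕ)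

/-- The canonical map from a tensor power to its completion. -/
def toTensorPowHat : TensorPow A q n →ₗ[ℂ] TensorPowHat A q n where
  toFun u := u
  map_add' := UniformSpace.Completion.coe_add
  map_smul' := UniformSpace.Completion.coe_smul

/-- The inclusion of a completed tensor power into the analytic tensor algebra. -/
def tensorPowHatIncl : TensorPowHat A q n →ₗ[ℂ] TensorHatPos A q :=
  WeightedSum.single (E := fun n : ℕ => TensorPowHat A q n) (fun n : ℕ => n + 1)
    (hatSeminorm A q) n

/-- The inclusion of a tensor power into the analytic tensor algebra. -/
def inclTensorPow [Algebra ℂ A] : TensorPow A q n →ₗ[ℂ] TensorHat A q :=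
  (LinearMap.inr ℂ A (TensorHatPos A q)).comp
    ((tensorPowHatIncl A q n).comp (toTensorPowHat A q n))

variable {n}

theorem inclTensorPow_tmul [Algebra ℂ A] (x : Fin (n + 1) → M) :
    inclTensorPow A q n (TensorPow.tmul A q n x) = inclTensor A q x :=
  rfl

end Completion

section HatEquiv

variable {A : Type*} [Ring A] [Algebra ℂ A] {α : A ≃ₐ[ℂ] A} {Λ κ : Type*}
  {p : Λ → Seminorm ℂ A} {q : κ → Seminorm ℂ (Twist α × Twist α⁻¹)}

/-- A representation by values `i_w(x)` turns into one by elementary tensors with the same entries,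
each of the `n + 1` factors costing one `C`. -/
theorem seminorm_wordTensor_le {k : κ} {l : Λ} {C : ℝ} (hC : 0 ≤ C)
    (h : ∀ i a, q k (letterIncl α i a) ≤ C * p l a) (n : ℕ) (w : Fin (n + 1) → Fin 2) (a : A) :
    TensorPow.seminorm A q n k (wordTensor q n w a) ≤
      C ^ (n + 1) * wordSeminorm α (p l) ⟨n + 1, w⟩ a := by
  refine le_wordSeminorm α (t := (TensorPow.seminorm A q n k).comp (wordTensor q n w))
    (pow_nonneg hC _) (fun x => ?_) a
  rw [Seminorm.comp_apply, ← tmul_letterIncl]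
  refine (projSeminorm_apply_le (TensorPow.span_tmul A q n) _).trans ?_
  refine (Finset.prod_le_prod (fun i _ => apply_nonneg _ _) fun i _ => h (w i) (x i)).trans_eq ?_
  simp [Finset.prod_mul_distrib]

theorem wordSeminorm_toWords_le {k : κ} {l : Λ} {C : ℝ} (hC : 0 ≤ C)
    (h : ∀ i m, p l (letterProj α i m) ≤ C * q k m) (n : ℕ) (w : Fin (n + 1) → Fin 2)
    (u : TensorPow A q n) :
    wordSeminorm α (p l) ⟨n + 1, w⟩ (toWords q n u w) ≤
      C ^ (n + 1) * TensorPow.seminorm A q n k u := by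
  refine le_projSeminorm (TensorPow.span_tmul A q n)
    (s := (wordSeminorm α (p l) ⟨n + 1, w⟩).comp ((LinearMap.proj w).comp (toWords q n)))
    (pow_nonneg hC _) (fun x => ?_) u
  rw [Seminorm.comp_apply, LinearMap.comp_apply, LinearMap.proj_apply, toWords_tmul]
  refine (wordSeminorm_wordMap_le α (p l) w _).trans ?_
  refine (Finset.prod_le_prod (fun i _ => apply_nonneg _ _) fun i _ => h (w i) (x i)).trans_eq ?_
  simp [Finset.prod_mul_distrib]

theorem hatSeminorm_coe (k : κ) (n : ℕ) (u : TensorPow A q n) :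
    hatSeminorm A q k n (u : TensorPowHat A q n) = TensorPow.seminorm A q n k u :=
  UniformSpace.Completion.extension_coe (TensorPow.uniformContinuous_seminorm A q n k) u

variable [UniformSpace A]

theorem exists_bound_letterIncl (hp : WithSeminorms p) (hpd : IsDirectedFamily p)
    (hq : WithSeminorms q) (k : κ) :
    ∃ l, ∃ C : ℝ, 1 ≤ C ∧ ∀ i a, q k (letterIncl α i a) ≤ C * p l a := by
  let s : Seminorm ℂ A := (q k).comp (letterInclLinear α 0) ⊔ (q k).comp (letterInclLinear α 1)
  have hs : Continuous s := ((hq.continuous_seminorm k).comp (continuous_letterIncl α 0)).max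
    ((hq.continuous_seminorm k).comp (continuous_letterIncl α 1))
  obtain ⟨l, C, hC, h⟩ := exists_bound_of_directed hp hpd hs
  refine ⟨l, C, hC, fun i a => le_trans ?_ (h a)⟩
  fin_cases i
  · exact le_max_left _ _
  · exact le_max_right _ _

theorem exists_bound_letterProj (hp : WithSeminorms p) (hq : WithSeminorms q)
    (hqd : IsDirectedFamily q) (l : Λ) :
    ∃ k, ∃ C : ℝ, 1 ≤ C ∧ ∀ i m, p l (letterProj α i m) ≤ C * q k m := by
  let s : Seminorm ℂ (Twist α × Twist α⁻¹) :=
    (p l).comp (letterProj α 0) ⊔ (p l).comp (letterProj α 1)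
  have hs : Continuous s := ((hp.continuous_seminorm l).comp (continuous_letterProj α 0)).max
    ((hp.continuous_seminorm l).comp (continuous_letterProj α 1))
  obtain ⟨k, C, hC, h⟩ := exists_bound_of_directed hq hqd hs
  refine ⟨k, C, hC, fun i a => le_trans ?_ (h a)⟩
  fin_cases i
  · exact le_max_left _ _
  · exact le_max_right _ _

theorem continuous_wordTensor (hA : IsArensMichael A fun a b => a * b) (hp : WithSeminorms p)
    (hpd : IsDirectedFamily p) (hq : WithSeminorms q) (n : ℕ) (w : Fin (n + 1) → Fin 2) :
    Continuous (wordTensor q n w) := by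
  have := hA.isUniformAddGroup
  have := hp.continuousSMul
  refine continuous_of_seminorm_bound
    (seminormUniformSpace_withSeminorms (TensorPow.seminorm A q n)) _ fun k => ?_
  obtain ⟨l, C, hC, h⟩ := exists_bound_letterIncl hp hpd hq k
  exact ⟨_, continuous_wordSeminorm α (hp.continuous_seminorm l) ⟨n + 1, w⟩, _,
    seminorm_wordTensor_le (zero_le_one.trans hC) h n w⟩

theorem continuous_toWords (hA : IsArensMichael A fun a b => a * b) (hα : Continuous α)
    (hα' : Continuous α.symm) (hp : WithSeminorms p) (hpd : IsDirectedFamily p)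
    (hq : WithSeminorms q) (hqd : IsDirectedFamily q) (n : ℕ) : Continuous (toWords q n) := by
  have hw := seminormUniformSpace_withSeminorms (TensorPow.seminorm A q n)
  have := hw.continuousSMul
  refine continuous_pi fun w => ?_
  refine continuous_of_seminorm_bound (withSeminorms_wordSeminorm hA hα hα' hp hpd ⟨n + 1, w⟩)
    ((LinearMap.proj w).comp (toWords q n)) fun l => ?_
  obtain ⟨k, C, hC, h⟩ := exists_bound_letterProj hp hq hqd l
  exact ⟨_, hw.continuous_seminorm k, _, wordSeminorm_toWords_le (zero_le_one.trans hC) h n w⟩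

/-- The coordinate isomorphism of the tensor power is a homeomorphism. -/
def tensorPowCLE (hA : IsArensMichael A fun a b => a * b) (hα : Continuous α)
    (hα' : Continuous α.symm) (hp : WithSeminorms p) (hpd : IsDirectedFamily p)
    (hq : WithSeminorms q) (hqd : IsDirectedFamily q) (n : ℕ) :
    TensorPow A q n ≃L[ℂ] ((Fin (n + 1) → Fin 2) → A) where
  toLinearEquiv := tensorPowEquiv q n
  continuous_toFun := continuous_toWords hA hα hα' hp hpd hq hqd n
  continuous_invFun := by
    change Continuous fun a => (tensorPowEquiv q n).symm a
    simp only [tensorPowEquiv_symm_apply]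
    exact continuous_finsetSum _ fun w _ =>
      (continuous_wordTensor hA hp hpd hq n w).comp (continuous_apply w)

theorem bijective_coe_completion {X : Type*} [UniformSpace X] [CompleteSpace X] [T0Space X] :
    Function.Bijective ((↑) : X → UniformSpace.Completion X) := by
  refine ⟨UniformSpace.Completion.coe_injective X, Set.range_eq_univ.1 ?_⟩
  have hc : IsClosed (Set.range ((↑) : X → UniformSpace.Completion X)) :=
    (UniformSpace.Completion.isUniformInducing_coe X).isComplete_range.isClosed
  rw [← hc.closure_eq]
  exact UniformSpace.Completion.denseRange_coe.closure_range

/-- The algebraic tensor power is homeomorphic to a finite product of copies of `A`, hence complete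
and Hausdorff already; completing it adds nothing. -/
theorem bijective_toTensorPowHat (hA : IsArensMichael A fun a b => a * b) (hα : Continuous α)
    (hα' : Continuous α.symm) (hp : WithSeminorms p) (hpd : IsDirectedFamily p)
    (hq : WithSeminorms q) (hqd : IsDirectedFamily q) (n : ℕ) :
    Function.Bijective (toTensorPowHat A q n) := by
  have := hA.isUniformAddGroup
  have := hA.completeSpace
  have := hA.t2Space
  have := completeSpace_of_equiv (tensorPowCLE hA hα hα' hp hpd hq hqd n).symm
  have : T2Space (TensorPow A q n) := T2Space.of_injective_continuous
    (tensorPowCLE hA hα hα' hp hpd hq hqd n).injective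
    (tensorPowCLE hA hα hα' hp hpd hq hqd n).continuous
  exact bijective_coe_completion

/-- The coordinates of an element of the completed tensor power. -/
def tensorPowHatEquiv (hA : IsArensMichael A fun a b => a * b) (hα : Continuous α)
    (hα' : Continuous α.symm) (hp : WithSeminorms p) (hpd : IsDirectedFamily p)
    (hq : WithSeminorms q) (hqd : IsDirectedFamily q) (n : ℕ) :
    TensorPowHat A q n ≃ₗ[ℂ] ((Fin (n + 1) → Fin 2) → A) :=
  (LinearEquiv.ofBijective _ (bijective_toTensorPowHat hA hα hα' hp hpd hq hqd n)).symm.trans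
    (tensorPowEquiv q n)

section

variable (hA : IsArensMichael A fun a b => a * b) (hα : Continuous α)
    (hα' : Continuous α.symm) (hp : WithSeminorms p) (hpd : IsDirectedFamily p)
    (hq : WithSeminorms q) (hqd : IsDirectedFamily q) (n : ℕ)

theorem tensorPowHatEquiv_coe (u : TensorPow A q n) :
    tensorPowHatEquiv hA hα hα' hp hpd hq hqd n (u : TensorPowHat A q n) = toWords q n u :=
  congrArg (tensorPowEquiv q n) ((LinearEquiv.ofBijective _
    (bijective_toTensorPowHat hA hα hα' hp hpd hq hqd n)).symm_apply_apply u)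

theorem tensorPowHatEquiv_symm_apply (a : (Fin (n + 1) → Fin 2) → A) :
    (tensorPowHatEquiv hA hα hα' hp hpd hq hqd n).symm a =
      ((∑ w, wordTensor q n w (a w) : TensorPow A q n) : TensorPowHat A q n) := by
  rw [← tensorPowEquiv_symm_apply]
  rfl

end

theorem boundedByWords_hat (hA : IsArensMichael A fun a b => a * b) (hα : Continuous α)
    (hα' : Continuous α.symm) (hp : WithSeminorms p) (hpd : IsDirectedFamily p)
    (hq : WithSeminorms q) (hqd : IsDirectedFamily q) :
    BoundedByWords (fun l w => wordSeminorm α (p l) w) (hatSeminorm A q)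
      (tensorPowHatEquiv hA hα hα' hp hpd hq hqd) := by
  intro k
  obtain ⟨l, C, hC, h⟩ := exists_bound_letterIncl hp hpd hq k
  refine ⟨l, C, zero_lt_one.trans_le hC, fun n a => ?_⟩
  rw [tensorPowHatEquiv_symm_apply, hatSeminorm_coe, Finset.mul_sum]
  exact (seminorm_sum_le _ _ _).trans (Finset.sum_le_sum fun w _ =>
    seminorm_wordTensor_le (zero_le_one.trans hC) h n w (a w))

theorem boundsWords_hat (hA : IsArensMichael A fun a b => a * b) (hα : Continuous α)
    (hα' : Continuous α.symm) (hp : WithSeminorms p) (hpd : IsDirectedFamily p)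
    (hq : WithSeminorms q) (hqd : IsDirectedFamily q) :
    BoundsWords (fun l w => wordSeminorm α (p l) w) (hatSeminorm A q)
      (tensorPowHatEquiv hA hα hα' hp hpd hq hqd) := by
  intro l
  obtain ⟨k, C, hC, h⟩ := exists_bound_letterProj hp hq hqd l
  -- The factor `2` accounts for the `2 ^ (n + 1)` words of length `n + 1`.
  refine ⟨k, 2 * C, by linarith, fun n y => ?_⟩
  obtain ⟨u, rfl⟩ := (bijective_toTensorPowHat hA hα hα' hp hpd hq hqd n).2 y
  change ∑ w, wordSeminorm α (p l) ⟨n + 1, w⟩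
    (tensorPowHatEquiv hA hα hα' hp hpd hq hqd n (u : TensorPowHat A q n) w) ≤
      (2 * C) ^ (n + 1) * hatSeminorm A q k n (u : TensorPowHat A q n)
  rw [tensorPowHatEquiv_coe, hatSeminorm_coe]
  refine (Finset.sum_le_sum fun w _ =>
    wordSeminorm_toWords_le (zero_le_one.trans hC) h n w u).trans_eq ?_
  simp [mul_pow, mul_assoc]

/-- The canonical map from skew power series to the analytic tensor algebra. -/
theorem exists_canonicalMap (hA : IsArensMichael A fun a b => a * b) (hα : Continuous α)
    (hα' : Continuous α.symm) (hp : WithSeminorms p) (hpd : IsDirectedFamily p)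
    (hq : WithSeminorms q) (hqd : IsDirectedFamily q) :
    ∃ ψ : SkewSeries α p ≃L[ℂ] TensorHat A q, IsCanonicalMap α p q ψ := by
  have : Nonempty Λ := hpd.1
  refine ⟨groupEquiv (boundedByWords_hat hA hα hα' hp hpd hq hqd)
    (boundsWords_hat hA hα hα' hp hpd hq hqd)
    (withSeminorms_wordSeminorm hA hα hα' hp hpd), fun f => ⟨?_, fun n => ?_⟩⟩
  · rw [Word.eq_nil]
    rfl
  · exact tensorPowHatEquiv_symm_apply hA hα hα' hp hpd hq hqd n _

end HatEquiv

/-! ### Properties of the canonical map -/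

section Canonical

variable {A : Type*} [Ring A] [Algebra ℂ A] {α : A ≃ₐ[ℂ] A} {Λ κ : Type*}
  {p : Λ → Seminorm ℂ A} {q : κ → Seminorm ℂ (Twist α × Twist α⁻¹)}

theorem SkewSeries.coeff_monomial_self (w : Word) (a : A) :
    SkewSeries.coeff α p (SkewSeries.monomial α p w a) w = a :=
  Pi.single_eq_same (M := fun _ : Word => A) w a

theorem SkewSeries.coeff_monomial_of_ne {w v : Word} (h : v ≠ w) (a : A) :
    SkewSeries.coeff α p (SkewSeries.monomial α p w a) v = 0 :=
  Pi.single_eq_of_ne (M := fun _ : Word => A) h a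

theorem IsCanonicalMap.unique {ψ ψ' : SkewSeries α p → TensorHat A q}
    (h : IsCanonicalMap α p q ψ) (h' : IsCanonicalMap α p q ψ') : ψ = ψ' := by
  funext f
  refine Prod.ext ((h f).1.trans (h' f).1.symm) (WeightedSum.ext fun n => ?_)
  exact ((h f).2 n).trans ((h' f).2 n).symm

theorem IsCanonicalMap.monomial_nil {ψ : SkewSeries α p → TensorHat A q}
    (h : IsCanonicalMap α p q ψ) (a : A) :
    ψ (SkewSeries.monomial α p Word.nil a) = inclZero A q a := by
  refine Prod.ext ?_ (WeightedSum.ext fun n => ?_)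
  · rw [(h _).1, Word.eq_nil]
    exact SkewSeries.coeff_monomial_self _ _
  · rw [(h _).2 n]
    have h0 : ∀ w : Fin (n + 1) → Fin 2,
        SkewSeries.coeff α p (SkewSeries.monomial α p Word.nil a) ⟨n + 1, w⟩ = 0 := fun w =>
      SkewSeries.coeff_monomial_of_ne (fun h => Nat.succ_ne_zero n (Sigma.mk.inj h).1) a
    simp only [h0, ← wordTensor_apply, map_zero, Finset.sum_const_zero]
    exact UniformSpace.Completion.coe_zero

theorem IsCanonicalMap.monomial_cons {ψ : SkewSeries α p → TensorHat A q}
    (h : IsCanonicalMap α p q ψ) {n : ℕ} (w : Fin (n + 1) → Fin 2) (a : A) :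
    ψ (SkewSeries.monomial α p ⟨n + 1, w⟩ a) =
      inclTensor A q fun k => letterIncl α (w k) ((Fin.cons a fun _ => 1 : Fin (n + 1) → A) k) := by
  refine Prod.ext ?_ (WeightedSum.ext fun m => ?_)
  · rw [(h _).1]
    exact SkewSeries.coeff_monomial_of_ne (fun h => Nat.succ_ne_zero n (Sigma.mk.inj h).1.symm) a
  · rw [(h _).2 m]
    simp only [← wordTensor_apply]
    change _ = (Pi.single n (wordTensor q n w a : TensorPowHat A q n) : ∀ n, TensorPowHat A q n) m
    rcases eq_or_ne m n with rfl | hm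
    · rw [Pi.single_eq_same, Fintype.sum_eq_single w]
      · congr 2
        exact SkewSeries.coeff_monomial_self _ _
      · intro v hv
        have h0 : SkewSeries.coeff α p (SkewSeries.monomial α p ⟨m + 1, w⟩ a) ⟨m + 1, v⟩ = 0 :=
          SkewSeries.coeff_monomial_of_ne
            (fun h => hv (eq_of_heq (Sigma.mk.inj h).2)) a
        rw [h0, map_zero]
    · rw [Pi.single_eq_of_ne hm, Finset.sum_eq_zero]
      · exact UniformSpace.Completion.coe_zero
      · intro v _
        have h0 : SkewSeries.coeff α p (SkewSeries.monomial α p ⟨n + 1, w⟩ a) ⟨m + 1, v⟩ = 0 :=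
          SkewSeries.coeff_monomial_of_ne
            (fun h => hm (Nat.succ_injective (Sigma.mk.inj h).1)) a
        rw [h0, map_zero]

end Canonical

/-! ### The analytic tensor algebra of the twisted bimodule -/

section TensorStructure

variable {A : Type*} [Ring A] [Algebra ℂ A] {α : A ≃ₐ[ℂ] A} {Λ κ : Type*}
  {p : Λ → Seminorm ℂ A} {q : κ → Seminorm ℂ (Twist α × Twist α⁻¹)}

/-- Elementary tensors are images of finite sums of monomials, so their products can be computed
among series. -/
theorem inclTensor_eq_sum {ψ : SkewSeries α p → TensorHat A q} (h : IsCanonicalMap α p q ψ)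
    {n : ℕ} (x : Fin (n + 1) → Twist α × Twist α⁻¹) :
    inclTensor A q x = ∑ w : Fin (n + 1) → Fin 2, ψ (SkewSeries.monomial α p ⟨n + 1, w⟩
      (wordMap α w fun k => letterProj α (w k) (x k))) := by
  rw [← inclTensorPow_tmul, tmul_eq_sum, map_sum]
  exact Finset.sum_congr rfl fun w _ => (h.monomial_cons w _).symm

theorem letterProj_append {m n : ℕ} (w : Fin m → Fin 2) (v : Fin n → Fin 2)
    (x : Fin m → Twist α × Twist α⁻¹) (y : Fin n → Twist α × Twist α⁻¹) :
    (fun k => letterProj α (Fin.append w v k) (Fin.append x y k)) =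
      Fin.append (fun k => letterProj α (w k) (x k)) fun k => letterProj α (v k) (y k) := by
  funext k
  induction k using Fin.addCases <;> simp

/-- The three product rules involving tensors correspond, word by word, to `wordMap_update_zero`,
`wordMap_update_last` and `wordMap_append`. -/
theorem isTensorAlgebraStructure_transport [UniformSpace A] [IsUniformAddGroup A]
    {μ : AlgStructure (SkewSeries α p)}
    (hμ : IsArensMichael (SkewSeries α p) fun f g => μ.mul f g)
    (h1 : μ.one = SkewSeries.monomial α p Word.nil 1)
    (hm : ∀ w v a b, μ.mul (SkewSeries.monomial α p w a) (SkewSeries.monomial α p v b) =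
      SkewSeries.monomial α p (w.append v) (a * (α ^ w.exp : A ≃ₐ[ℂ] A) b))
    (ψ : SkewSeries α p ≃L[ℂ] TensorHat A q) (hψ : IsCanonicalMap α p q ψ) :
    IsTensorAlgebraStructure A q (μ.transport ψ.toLinearEquiv) := by
  have hmul : ∀ w v a b, (μ.transport ψ.toLinearEquiv).mul
      (ψ (SkewSeries.monomial α p w a)) (ψ (SkewSeries.monomial α p v b)) =
        ψ (SkewSeries.monomial α p (w.append v) (a * (α ^ w.exp : A ≃ₐ[ℂ] A) b)) := by
    intro w v a b
    refine (AlgStructure.transport_mul ψ.toLinearEquiv μ _ _).trans ?_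
    rw [hm]
    rfl
  refine ⟨hμ.transport ψ, ?_, fun a b => ?_, fun a n x => ?_, fun a n x => ?_, fun {m n} x y => ?_⟩
  · refine (congrArg ψ h1).trans ?_
    exact hψ.monomial_nil 1
  · rw [← hψ.monomial_nil, ← hψ.monomial_nil, hmul, Word.nil_append, Word.exp_nil, zpow_zero_apply,
      hψ.monomial_nil]
  · rw [inclTensor_eq_sum hψ, inclTensor_eq_sum hψ, ← hψ.monomial_nil, map_sum]
    refine Finset.sum_congr rfl fun w _ => ?_
    rw [hmul, Word.nil_append, Word.exp_nil, zpow_zero_apply, letterProj_update, letterProj_smul]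
    rw [wordMap_update_zero α w a fun k => letterProj α (w k) (x k)]
  · rw [inclTensor_eq_sum hψ, inclTensor_eq_sum hψ, ← hψ.monomial_nil, map_sum,
      LinearMap.sum_apply]
    refine Finset.sum_congr rfl fun w _ => ?_
    rw [hmul, Word.append_nil, letterProj_update, letterProj_op_smul]
    rw [wordMap_update_last α w a fun k => letterProj α (w k) (x k)]
    rfl
  · have h := inclTensor_eq_sum hψ (n := m + 1 + n) (Fin.append x y : Fin (m + 1 + (n + 1)) → _)
    refine Eq.trans ?_ h.symm
    rw [inclTensor_eq_sum hψ, inclTensor_eq_sum hψ]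
    simp only [map_sum, LinearMap.sum_apply, hmul]
    rw [Finset.sum_comm, ← Fintype.sum_prod_type']
    -- Concatenation matches pairs of words of the given lengths with words of the total length.
    refine Fintype.sum_equiv (Fin.appendEquiv (m + 1) (n + 1)) _ _ fun wv => ?_
    refine congrArg ψ (congrArg (SkewSeries.monomial α p
      ⟨m + 1 + (n + 1), Fin.append wv.1 wv.2⟩) ?_)
    refine (wordMap_append α wv.1 wv.2 _ _).symm.trans ?_
    rw [← letterProj_append]
    rfl

/-- The axioms prescribe products of degree zero elements and elementary tensors. The images of
monomials under `ψ` are of this kind and span a dense subspace, so separate continuity settles the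
rest. -/
theorem IsTensorAlgebraStructure.unique [UniformSpace A] {T T' : AlgStructure (TensorHat A q)}
    (hT : IsTensorAlgebraStructure A q T) (hT' : IsTensorAlgebraStructure A q T')
    (ψ : SkewSeries α p ≃L[ℂ] TensorHat A q) (hψ : IsCanonicalMap α p q ψ) : T = T' := by
  have := hT.isArensMichael.t2Space
  let G : TensorHat A q → Prop := fun x => (∃ a, x = inclZero A q a) ∨
    ∃ (n : ℕ) (y : Fin (n + 1) → Twist α × Twist α⁻¹), x = inclTensor A q y
  have hG : ∀ x y, G x → G y → T.mul x y = T'.mul x y := by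
    rintro _ _ (⟨a, rfl⟩ | ⟨m, x, rfl⟩) (⟨b, rfl⟩ | ⟨n, y, rfl⟩)
    · exact (hT.zero_mul_zero a b).trans (hT'.zero_mul_zero a b).symm
    · exact (hT.zero_mul_tensor a y).trans (hT'.zero_mul_tensor a y).symm
    · exact (hT.tensor_mul_zero b x).trans (hT'.tensor_mul_zero b x).symm
    · exact (hT.tensor_mul_tensor x y).trans (hT'.tensor_mul_tensor x y).symm
  have hgen : ∀ w : Word, ∀ a : A, G (ψ (SkewSeries.monomial α p w a)) := by
    rintro ⟨n, w⟩ a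
    cases n with
    | zero => exact Or.inl ⟨a, by rw [Word.eq_nil, hψ.monomial_nil]⟩
    | succ n => exact Or.inr ⟨n, _, hψ.monomial_cons w a⟩
  have h0 : ∀ w a v b, T.mul (ψ (SkewSeries.monomial α p w a)) (ψ (SkewSeries.monomial α p v b)) =
      T'.mul (ψ (SkewSeries.monomial α p w a)) (ψ (SkewSeries.monomial α p v b)) :=
    fun w a v b => hG _ _ (hgen w a) (hgen v b)
  have hr := hT.isArensMichael.continuous_right
  have hr' := hT'.isArensMichael.continuous_right
  have hl := hT.isArensMichael.continuous_left
  have hl' := hT'.isArensMichael.continuous_left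
  have hc : Continuous (ψ : SkewSeries α p →ₗ[ℂ] TensorHat A q) := ψ.continuous
  have h1 : ∀ w a g, T.mul (ψ (SkewSeries.monomial α p w a)) (ψ g) =
      T'.mul (ψ (SkewSeries.monomial α p w a)) (ψ g) := by
    intro w a
    have e : (T.mul (ψ (SkewSeries.monomial α p w a))).comp
        (ψ : SkewSeries α p →ₗ[ℂ] TensorHat A q) =
        (T'.mul (ψ (SkewSeries.monomial α p w a))).comp
          (ψ : SkewSeries α p →ₗ[ℂ] TensorHat A q) :=
      SkewSeries.linearMap_ext ((hr _).comp hc) ((hr' _).comp hc) (h0 w a)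
    exact fun g => LinearMap.congr_fun e g
  have h2 : ∀ f g, T.mul (ψ f) (ψ g) = T'.mul (ψ f) (ψ g) := by
    intro f g
    have e : (T.mul.flip (ψ g)).comp (ψ : SkewSeries α p →ₗ[ℂ] TensorHat A q) =
        (T'.mul.flip (ψ g)).comp (ψ : SkewSeries α p →ₗ[ℂ] TensorHat A q) :=
      SkewSeries.linearMap_ext ((hl _).comp hc) ((hl' _).comp hc) fun w a => h1 w a g
    exact LinearMap.congr_fun e f
  refine AlgStructure.ext_mul fun x y => ?_
  obtain ⟨f, rfl⟩ := ψ.surjective x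
  obtain ⟨g, rfl⟩ := ψ.surjective y
  exact h2 f g

/-- The formula leaves no choice for `ψ`, so the multiplication of series is the pullback of `T`. -/
theorem IsCanonicallyIso.unique [UniformSpace A] {T : AlgStructure (TensorHat A q)}
    {μ μ' : AlgStructure (SkewSeries α p)} (h : IsCanonicallyIso α p q T μ)
    (h' : IsCanonicallyIso α p q T μ') : μ = μ' := by
  obtain ⟨ψ, hψ, -, hm, -⟩ := h
  obtain ⟨ψ', hψ', -, hm', -⟩ := h'
  have e := hψ.unique hψ'
  refine AlgStructure.ext_mul fun f g => ψ.injective ?_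
  rw [hm, e, hm']

end TensorStructure

end AnalyticOre

end

/-! ### The theorem, assembled from existence, transport and uniqueness. -/

theorem theorem3p1 {A : Type*} [Ring A] [Algebra ℂ A] [UniformSpace A]
    (hA : AnalyticOre.IsArensMichael A (fun a b => a * b))
    (α : A ≃ₐ[ℂ] A) (hα : Continuous α) (hα' : Continuous α.symm)
    {Λ : Type*} (p : Λ → Seminorm ℂ A) (hp : WithSeminorms p)
    (hpd : AnalyticOre.IsDirectedFamily p)
    {κ : Type*} (q : κ → Seminorm ℂ (AnalyticOre.Twist α × AnalyticOre.Twist α⁻¹))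
    (hq : WithSeminorms q) (hqd : AnalyticOre.IsDirectedFamily q) :
    (∃! T : AnalyticOre.AlgStructure (AnalyticOre.TensorHat A q),
      AnalyticOre.IsTensorAlgebraStructure A q T) ∧
    ∀ T : AnalyticOre.AlgStructure (AnalyticOre.TensorHat A q),
      AnalyticOre.IsTensorAlgebraStructure A q T →
      (∃! μ : AnalyticOre.AlgStructure (AnalyticOre.SkewSeries α p),
        (AnalyticOre.IsOreHom μ (AnalyticOre.oreIncl α p α 0) ∧
          AnalyticOre.IsOreHom μ (AnalyticOre.oreIncl α p α⁻¹ 1)) ∧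
        AnalyticOre.IsCanonicallyIso α p q T μ) ∧
      ∀ μ : AnalyticOre.AlgStructure (AnalyticOre.SkewSeries α p),
        (AnalyticOre.IsOreHom μ (AnalyticOre.oreIncl α p α 0) ∧
          AnalyticOre.IsOreHom μ (AnalyticOre.oreIncl α p α⁻¹ 1)) ∧
        AnalyticOre.IsCanonicallyIso α p q T μ →
        AnalyticOre.IsArensMichael (AnalyticOre.SkewSeries α p) (fun f g => μ.mul f g) := by
  have := hA.isUniformAddGroup
  obtain ⟨ψ, hψ⟩ := AnalyticOre.exists_canonicalMap hA hα hα' hp hpd hq hqd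
  obtain ⟨μ, hμ, h1, hm⟩ := AnalyticOre.SkewSeries.exists_structure hA hα hα' hp hpd
  have hT := AnalyticOre.isTensorAlgebraStructure_transport hμ h1 hm ψ hψ
  have hiso : ∀ T, AnalyticOre.IsTensorAlgebraStructure A q T →
      AnalyticOre.IsCanonicallyIso α p q T μ := by
    intro T hT'
    -- By uniqueness `T` is the transported structure, for which `ψ` is multiplicative by
    -- construction.
    obtain rfl := hT'.unique hT ψ hψ
    refine ⟨ψ, hψ, rfl, fun f g => ?_, fun a => ?_⟩
    · exact (AnalyticOre.AlgStructure.transport_mul ψ.toLinearEquiv μ f g).symm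
    · rw [AnalyticOre.Word.eq_nil]
      exact hψ.monomial_nil a
  refine ⟨⟨_, hT, fun T hT' => hT'.unique hT ψ hψ⟩, fun T hT' => ⟨⟨μ, ⟨⟨?_, ?_⟩, hiso T hT'⟩,
    fun μ' h => h.2.unique (hiso T hT')⟩, fun μ' h => ?_⟩⟩
  · exact AnalyticOre.SkewSeries.isOreHom_oreIncl h1 hm α 0 (by simp [AnalyticOre.letterExp])
  · exact AnalyticOre.SkewSeries.isOreHom_oreIncl h1 hm α⁻¹ 1 (by simp [AnalyticOre.letterExp])
  · obtain rfl := h.2.unique (hiso T hT')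
    exact hμ
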